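/- Let $\Omega\subset\mathbb R^d$, $d\in\{2,3\}$, be open and bounded, $T>0$, and let $r\ge 1$ be an integer. Write $\|\cdot\|$ and $\langle\cdot,\cdot\rangle$ for the $L^2(\Omega)$ norm and inner product, $V=H^1_0(\Omega)^d$, $Q=L^2_0(\Omega)=\{q\in L^2(\Omega):\int_\Omega q\,dx=0\}$, $a(v,w)=\langle\nabla v,\nabla w\rangle$, $b(v,q)=-\langle\nabla\cdot v,q\rangle$. **Continuous problem.** Let $(u,p)$, with $u(t)\in V\cap H^{r+1}(\Omega)^d$ and $p(t)\in Q\cap H^r(\Omega)$, satisfy $$\partial_t u-\Delta u+\nabla p=f,\qquad \nabla\cdot u=0\quad\text{in }\Omega\times[0,T],\qquad u(0)=u_0,\qquad u=0\ \text{on }\partial\Omega\times[0,T],$$ with $f(t)\in L^2(\Omega)^d$, and suppose that the solution is regular up to $t=0$: $u\in C^3([0,T];L^2(\Omega)^d)\cap C^1([0,T];H^{r+1}(\Omega)^d)$ and $p\in C^2([0,T];L^2(\Omega))\cap C^1([0,T];H^r(\Omega))$. **Space discretization.** Let $\beta>0$ and $c$ be constants. For $h>0$ consider finite-dimensional spaces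 $V_h\subset V$, $Q_h\subset Q$ such that $$\beta\le\inf_{q_h\in Q_h\setminus\{0\}}\ \sup_{v_h\in V_h\setminus\{0\}}\frac{b(v_h,q_h)}{\|v_h\|_1\,\|q_h\|},$$ and such that for all $v\in V\cap H^{r+1}(\Omega)^d$ and $q\in Q\cap H^r(\Omega)$ there are $i_hv\in V_h$, $j_hq\in Q_h$ with $$\|v-i_hv\|+h\|\nabla(v-i_hv)\|\le c\,h^{r+1}\|v\|_{r+1},\qquad \|q-j_hq\|\le c\,h^{r}\|q\|_{r}.$$ Let $V_h^{\mathrm{div}}=\{v_h\in V_h: b(v_h,q_h)=0\ \ \forall q_h\in Q_h\}$. The Stokes projection $R_h(u,p)=(R_h^u(u,p),R_h^p(u,p))\in V_h\times Q_h$ is the unique pair $(\hat u_h,\hat p_h)$ with $a(\hat u_h,v_h)+b(v_h,\hat p_h)=a(u,v_h)+b(v_h,p)$ for all $v_h\in V_h$ and $b(\hat u_h,q_h)=0$ for all $q_h\in Q_h$. **Space-time scheme.** Let $0=t_0<t_1<\dots<t_N=T$, $I_m=(t_{m-1},t_m]$, $\tau_m=t_m-t_{m-1}$, $\tau=\max_m\tau_m$,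 $\bar t_m=(t_{m-1}+t_m)/2$, and let $u_{0,h}\in V_h^{\mathrm{div}}$. A discrete solution is a pair $(u_{\tau,h},p_{\tau,h})$ in which $u_{\tau,h}:[0,T]\to V_h$ is continuous and affine on each $I_m$, $p_{\tau,h}:(0,T]\to Q_h$ is affine on each $I_m$ (jumps at the $t_m$ are allowed), $u_{\tau,h}(0)=u_{0,h}$, and for all $m=1,\dots,N$, $v_h\in V_h$, $q_h\in Q_h$ $$\int_{I_m}\big(\langle\partial_tu_{\tau,h},v_h\rangle+a(u_{\tau,h},v_h)+b(v_h,p_{\tau,h})\big)\,dt=\frac{\tau_m}{2}\,\langle f(t_{m-1})+f(t_m),v_h\rangle,\qquad \int_{I_m}b(u_{\tau,h},q_h)\,dt=0 .$$ The pressure part of a discrete solution is not unique. **Claim.** Let $e^u_{\tau,h}(0)=R_h^u(u(0),p(0))-u_{0,h}$. There is a constant $C$, which may depend on $\Omega,T,r,\beta,c$ and $(u,p,f)$ but not on $h$, $V_h$, $Q_h$, the time mesh, $u_{0,h}$ or the discrete solution, such that for every $h>0$, all such $V_h,Q_h$, every time mesh, every $u_{0,h}\in V_h^{\mathrm{div}}$,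 every discrete solution $(u_{\tau,h},p_{\tau,h})$ and every $n=1,\dots,N$ $$\sum_{m=1}^{n}\tau_m\,\|p(\bar t_m)-p_{\tau,h}(\bar t_m)\|^2\le C\left(\|\nabla e^u_{\tau,h}(0)\|^2+\tau^4+h^{2r}\right).$$ -/

import Mathlib

open MeasureTheory Set
open scoped ContDiff RealInnerProductSpace

noncomputable section

namespace StokesFEM

/-! ## Sobolev spaces on an open set `Ω ⊆ ℝ^d` -/

/-- The Euclidean space `ℝ^d`. -/
abbrev E (d : ℕ) : Type := EuclideanSpace ℝ (Fin d)

variable {d : ℕ}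

/-- `L²(Ω; F)`, a Hilbert space; `F = ℝ` for scalar functions, `F = ℝ^d` for vector fields. -/
abbrev L2 (Ω : Set (E d)) (F : Type) [NormedAddCommGroup F] : Type :=
  Lp F 2 (volume.restrict Ω)

/-- `φ ∈ C_c^∞(Ω; F)`. -/
structure IsTestFunction (Ω : Set (E d)) {F : Type} [NormedAddCommGroup F] [NormedSpace ℝ F]
    (φ : E d → F) : Prop where
  smooth : ContDiff ℝ ∞ φ
  compactSupport : HasCompactSupport φ
  support_subset : tsupport φ ⊆ Ω

/-- The classical iterated partial derivative `∂_{w 0} ⋯ ∂_{w (k-1)} φ`. -/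
def partialD {k : ℕ} (w : Fin k → Fin d) (φ : E d → ℝ) (x : E d) : ℝ :=
  iteratedFDeriv ℝ k φ x (fun j => EuclideanSpace.single (w j) (1 : ℝ))

/-- The labels of the partial derivatives of order at most `m`: finite sequences of at most `m`
coordinate directions. -/
abbrev Word (d m : ℕ) : Type := Σ k : Fin (m + 1), (Fin (k : ℕ) → Fin d)

lemma integrable_partialD_smul {Ω : Set (E d)} {F : Type} [NormedAddCommGroup F]
    [InnerProductSpace ℝ F] {φ : E d → ℝ} (hφ : IsTestFunction Ω φ) {k : ℕ}
    (w : Fin k → Fin d) (u : L2 Ω F) :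
    Integrable (fun x => partialD w φ x • (u x : F)) (volume.restrict Ω) := by
  have hc : Continuous (partialD w φ) := by
    have h1 : Continuous (iteratedFDeriv ℝ k φ) :=
      hφ.smooth.continuous_iteratedFDeriv (by exact_mod_cast le_top)
    unfold partialD
    fun_prop
  have hs : HasCompactSupport (partialD w φ) := by
    have h2 : HasCompactSupport (iteratedFDeriv ℝ k φ) := hφ.compactSupport.iteratedFDeriv k
    refine h2.mono' (subset_trans ?_ subset_closure)
    intro x hx h0
    apply hx
    simp only [partialD]
    rw [h0]
    rfl
  have hm : MemLp (partialD w φ) 2 (volume.restrict Ω) :=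
    (hc.memLp_of_hasCompactSupport hs).restrict Ω
  exact memLp_one_iff_integrable.mp (MemLp.smul (r := 1) (Lp.memLp u) hm)

lemma partialD_zero (w : Fin 0 → Fin d) (φ : E d → ℝ) : partialD w φ = φ := by
  funext x
  simp [partialD]

lemma integrable_smul {Ω : Set (E d)} {F : Type} [NormedAddCommGroup F]
    [InnerProductSpace ℝ F] {φ : E d → ℝ} (hφ : IsTestFunction Ω φ) (u : L2 Ω F) :
    Integrable (fun x => φ x • (u x : F)) (volume.restrict Ω) := by
  have h := integrable_partialD_smul hφ (Fin.elim0 : Fin 0 → Fin d) u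
  rwa [partialD_zero] at h

/-- `g` is the weak partial derivative `∂_{w 0} ⋯ ∂_{w (k-1)} u`. -/
def IsWeakD {Ω : Set (E d)} {F : Type} [NormedAddCommGroup F] [InnerProductSpace ℝ F] {k : ℕ}
    (w : Fin k → Fin d) (u g : L2 Ω F) : Prop :=
  ∀ φ : E d → ℝ, IsTestFunction Ω φ →
    ∫ x in Ω, partialD w φ x • (u x : F) = (-1 : ℝ) ^ k • ∫ x in Ω, φ x • (g x : F)

/-- The Sobolev space `H^m(Ω; F)` with its Hilbert space structure. A function is stored together
with its weak partial derivatives of order at most `m`, all of them in `L²`; the norm is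
`‖u‖_m = (∑ ‖D^w u‖²)^{1/2}`, the sum over all partial derivatives of order at most `m`. -/
def Sobolev (Ω : Set (E d)) (F : Type) [NormedAddCommGroup F] [InnerProductSpace ℝ F] (m : ℕ) :
    Submodule ℝ (PiLp 2 (fun _ : Word d m => L2 Ω F)) where
  carrier := {U | ∀ w : Word d m, IsWeakD w.2 (U ⟨0, Fin.elim0⟩) (U w)}
  zero_mem' := by
    intro w φ hφ
    have h0 : ((0 : L2 Ω F) : E d → F) =ᵐ[volume.restrict Ω] 0 := Lp.coeFn_zero F 2 _
    have e1 : ∫ x in Ω, partialD w.2 φ x • ((0 : L2 Ω F) x : F) = 0 := by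
      rw [integral_congr_ae (g := fun _ => (0 : F)) (h0.mono fun x hx => by
        dsimp only
        rw [hx, Pi.zero_apply, smul_zero])]
      simp
    have e2 : ∫ x in Ω, φ x • ((0 : L2 Ω F) x : F) = 0 := by
      rw [integral_congr_ae (g := fun _ => (0 : F)) (h0.mono fun x hx => by
        dsimp only
        rw [hx, Pi.zero_apply, smul_zero])]
      simp
    simp only [PiLp.zero_apply]
    rw [e1, e2, smul_zero]
  add_mem' := by
    intro U V hU hV w φ hφ
    have key : ∀ (ψ : E d → ℝ), (∀ u : L2 Ω F, Integrable (fun x => ψ x • (u x : F))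
        (volume.restrict Ω)) → ∀ a b : L2 Ω F, ∫ x in Ω, ψ x • ((a + b : L2 Ω F) x : F)
        = (∫ x in Ω, ψ x • (a x : F)) + ∫ x in Ω, ψ x • (b x : F) := by
      intro ψ hψ a b
      rw [← integral_add (hψ a) (hψ b)]
      refine integral_congr_ae ((Lp.coeFn_add a b).mono fun x hx => ?_)
      simp only [hx, Pi.add_apply, smul_add]
    simp only [PiLp.add_apply]
    rw [key _ (integrable_partialD_smul hφ w.2), key _ (integrable_smul hφ), smul_add,
      hU w φ hφ, hV w φ hφ]
  smul_mem' := by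
    intro c U hU w φ hφ
    have key : ∀ (ψ : E d → ℝ) (a : L2 Ω F), ∫ x in Ω, ψ x • ((c • a : L2 Ω F) x : F)
        = c • ∫ x in Ω, ψ x • (a x : F) := by
      intro ψ a
      rw [← integral_smul]
      refine integral_congr_ae ((Lp.coeFn_smul c a).mono fun x hx => ?_)
      simp only [hx, Pi.smul_apply, smul_comm c]
    simp only [PiLp.smul_apply]
    rw [key, key, hU w φ hφ, smul_comm c]

section SobolevOps

variable {Ω : Set (E d)} {F : Type} [NormedAddCommGroup F] [InnerProductSpace ℝ F] {m : ℕ}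

/-- The weak derivative `∂_{w 0} ⋯ ∂_{w (k-1)} u` of `u ∈ H^m`, for `k ≤ m`. -/
def weakD {k : ℕ} (hk : k ≤ m) (w : Fin k → Fin d) (u : Sobolev Ω F m) : L2 Ω F :=
  u.1 ⟨⟨k, Nat.lt_succ_of_le hk⟩, w⟩

/-- The embedding `H^m(Ω; F) → L²(Ω; F)`. -/
def toL2 (u : Sobolev Ω F m) : L2 Ω F :=
  weakD (Nat.zero_le m) Fin.elim0 u

/-- The embedding `H^m(Ω; F) → H^1(Ω; F)` for `m ≥ 1`. -/
def toH1 (hm : 1 ≤ m) (u : Sobolev Ω F m) : Sobolev Ω F 1 :=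
  ⟨WithLp.toLp 2 fun w : Word d 1 =>
      u.1 ⟨⟨w.1, lt_of_lt_of_le w.1.2 (Nat.succ_le_succ hm)⟩, w.2⟩,
    fun w => u.2 ⟨⟨w.1, lt_of_lt_of_le w.1.2 (Nat.succ_le_succ hm)⟩, w.2⟩⟩

/-- The weak first order partial derivative `∂_i u`, for `u ∈ H^m` with `m ≥ 1`. -/
def pd (hm : 1 ≤ m) (i : Fin d) (u : Sobolev Ω F m) : L2 Ω F :=
  weakD hm (fun _ : Fin 1 => i) u

/-- The Laplacian `Δu = ∑ i, ∂_i ∂_i u`, for `u ∈ H^m` with `m ≥ 2`. -/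
def laplacian (hm : 2 ≤ m) (u : Sobolev Ω F m) : L2 Ω F :=
  ∑ i : Fin d, weakD hm (fun _ : Fin 2 => i) u

end SobolevOps

variable {Ω : Set (E d)}

/-- `H^1(Ω)^d`. -/
abbrev H1 (Ω : Set (E d)) : Type := Sobolev Ω (E d) 1

/-- `V = H^1_0(Ω)^d`: the closure in `H^1` of the smooth vector fields with compact support
in `Ω`. -/
def V (Ω : Set (E d)) : Submodule ℝ (H1 Ω) :=
  (Submodule.span ℝ {v : H1 Ω | ∃ φ : E d → E d, IsTestFunction Ω φ ∧
    (toL2 v : E d → E d) =ᵐ[volume.restrict Ω] φ}).topologicalClosure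

/-- `Q = L²_0(Ω)`: the square integrable functions with vanishing integral. -/
def Q (Ω : Set (E d)) : Set (L2 Ω ℝ) := {q | ∫ x in Ω, (q x : ℝ) = 0}

/-- The divergence `∇ · v = ∑ i, ∂_i v_i`. -/
def divergence (v : H1 Ω) : L2 Ω ℝ :=
  ∑ i : Fin d, (EuclideanSpace.proj i : E d →L[ℝ] ℝ).compLp (pd le_rfl i v)

/-- The gradient `∇q = ∑ i, (∂_i q) e_i` of a scalar function, for `q ∈ H^m` with `m ≥ 1`. -/
def gradient {m : ℕ} (hm : 1 ≤ m) (q : Sobolev Ω ℝ m) : L2 Ω (E d) :=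
  ∑ i : Fin d, (ContinuousLinearMap.toSpanSingleton ℝ
    (EuclideanSpace.single i (1 : ℝ) : E d)).compLp (pd hm i q)

/-- The squared `L²` norm `‖∇v‖²` of the Jacobian of a vector field. -/
def gradNormSq (v : H1 Ω) : ℝ := ∑ i : Fin d, ‖pd le_rfl i v‖ ^ 2

/-- `‖∇v‖`. -/
def gradNorm (v : H1 Ω) : ℝ := Real.sqrt (gradNormSq v)

/-- `a(u, v) = ⟨∇u, ∇v⟩`. -/
def a (u v : H1 Ω) : ℝ := ∑ i : Fin d, ⟪pd le_rfl i u, pd le_rfl i v⟫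

/-- `b(v, q) = -⟨∇ · v, q⟩`. -/
def b (v : H1 Ω) (q : L2 Ω ℝ) : ℝ := -⟪divergence v, q⟫

/-! ## The nonstationary Stokes problem -/

/-- `(u, p)` with `u(t) ∈ H^{r+1}`, `p(t) ∈ H^r`, `r ≥ 1`, solves
`∂_t u - Δu + ∇p = f`, `∇ · u = 0` in `Ω × [0, T]`, `u(0) = u₀`, `u = 0` on `∂Ω × [0, T]`,
where the pressure has mean value zero. -/
structure IsStokesSolution (T : ℝ) (f : ℝ → L2 Ω (E d)) (u₀ : L2 Ω (E d)) {r : ℕ} (hr : 1 ≤ r)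
    (u : ℝ → Sobolev Ω (E d) (r + 1)) (p : ℝ → Sobolev Ω ℝ r) : Prop where
  momentum : ∀ t ∈ Icc 0 T,
    derivWithin (fun s => toL2 (u s)) (Icc 0 T) t
      - laplacian (Nat.succ_le_succ hr) (u t) + gradient hr (p t) = f t
  divergence_free : ∀ t ∈ Icc 0 T, divergence (toH1 (Nat.le_add_left 1 r) (u t)) = 0
  initial : toL2 (u 0) = u₀
  boundary : ∀ t ∈ Icc 0 T, toH1 (Nat.le_add_left 1 r) (u t) ∈ V Ω
  mean_zero : ∀ t ∈ Icc 0 T, toL2 (p t) ∈ Q Ω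

/-- `u ∈ C³([0,T]; L²) ∩ C¹([0,T]; H^{r+1})` and `p ∈ C²([0,T]; L²) ∩ C¹([0,T]; H^r)`. -/
structure IsRegular (T : ℝ) {r : ℕ}
    (u : ℝ → Sobolev Ω (E d) (r + 1)) (p : ℝ → Sobolev Ω ℝ r) : Prop where
  velocity_L2 : ContDiffOn ℝ 3 (fun t => toL2 (u t)) (Icc 0 T)
  velocity_Sobolev : ContDiffOn ℝ 1 u (Icc 0 T)
  pressure_L2 : ContDiffOn ℝ 2 (fun t => toL2 (p t)) (Icc 0 T)
  pressure_Sobolev : ContDiffOn ℝ 1 p (Icc 0 T)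

/-! ## Discretization in space -/

/-- A pair of conforming finite element spaces `V_h ⊆ V`, `Q_h ⊆ Q` with mesh size `h` that
satisfies the inf-sup condition with constant `β` and has the approximation properties of
order `r` with constant `c`. -/
structure IsStablePair (r : ℕ) (β c h : ℝ) (Vh : Submodule ℝ (H1 Ω))
    (Qh : Submodule ℝ (L2 Ω ℝ)) : Prop where
  finiteDimensional_velocity : FiniteDimensional ℝ Vh
  finiteDimensional_pressure : FiniteDimensional ℝ Qh
  velocity_le : Vh ≤ V Ω
  pressure_subset : (Qh : Set (L2 Ω ℝ)) ⊆ Q Ω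
  inf_sup : ∀ q ∈ Qh, q ≠ 0 →
    β ≤ ⨆ v : {v : H1 Ω // v ∈ Vh ∧ v ≠ 0}, b v.1 q / (‖v.1‖ * ‖q‖)
  approx_velocity : ∀ v : Sobolev Ω (E d) (r + 1), toH1 (Nat.le_add_left 1 r) v ∈ V Ω →
    ∃ vh ∈ Vh, ‖toL2 v - toL2 vh‖ + h * gradNorm (toH1 (Nat.le_add_left 1 r) v - vh)
      ≤ c * h ^ (r + 1) * ‖v‖
  approx_pressure : ∀ q : Sobolev Ω ℝ r, toL2 q ∈ Q Ω →
    ∃ qh ∈ Qh, ‖toL2 q - qh‖ ≤ c * h ^ r * ‖q‖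

/-- `V_h^div`, the discretely divergence-free functions. -/
def Vdiv (Vh : Submodule ℝ (H1 Ω)) (Qh : Submodule ℝ (L2 Ω ℝ)) : Set (H1 Ω) :=
  {v | v ∈ Vh ∧ ∀ q ∈ Qh, b v q = 0}

/-- `z = (û_h, p̂_h) ∈ V_h × Q_h` is the Stokes projection of `(u, p)`. -/
structure IsStokesProjection (Vh : Submodule ℝ (H1 Ω)) (Qh : Submodule ℝ (L2 Ω ℝ))
    (u : H1 Ω) (p : L2 Ω ℝ) (z : H1 Ω × L2 Ω ℝ) : Prop where
  velocity_mem : z.1 ∈ Vh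
  pressure_mem : z.2 ∈ Qh
  momentum : ∀ v ∈ Vh, a z.1 v + b v z.2 = a u v + b v p
  continuity : ∀ q ∈ Qh, b z.1 q = 0

/-- The Stokes projection `R_h(u, p)`. The defining system has exactly one solution for every
pair of spaces that satisfies `IsStablePair` with `β > 0`, if `Ω` is bounded. -/
def stokesProjection (Vh : Submodule ℝ (H1 Ω)) (Qh : Submodule ℝ (L2 Ω ℝ))
    (u : H1 Ω) (p : L2 Ω ℝ) : H1 Ω × L2 Ω ℝ :=
  Classical.epsilon (IsStokesProjection Vh Qh u p)

/-- The discrete initial velocity error `e^u_{τ,h}(0) = R_h^u(u(0), p(0)) - u_{0,h}`. (The discrete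
error is `R_h^u(R_τ u, R_τ p) - u_{τ,h}` with the interpolation operator `R_τ` in time, which
satisfies `R_τ w (0) = w (0)`.) -/
def initialError (Vh : Submodule ℝ (H1 Ω)) (Qh : Submodule ℝ (L2 Ω ℝ))
    (u : H1 Ω) (p : L2 Ω ℝ) (u₀h : H1 Ω) : H1 Ω :=
  (stokesProjection Vh Qh u p).1 - u₀h

/-! ## Discretization in time -/

/-- A partition `0 = t_0 < t_1 < ⋯ < t_N = T`; the values `t n` with `n > N` play no role. The
subinterval with number `n < N` is `(t n, t (n+1)]`. -/
structure TimeMesh (T : ℝ) where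
  N : ℕ
  t : ℕ → ℝ
  t_zero : t 0 = 0
  t_last : t N = T
  t_lt : ∀ n < N, t n < t (n + 1)

namespace TimeMesh

variable {T : ℝ} (M : TimeMesh T)

/-- The length of the subinterval with number `n`. -/
def step (n : ℕ) : ℝ := M.t (n + 1) - M.t n

/-- The midpoint of the subinterval with number `n`. -/
def mid (n : ℕ) : ℝ := (M.t n + M.t (n + 1)) / 2

/-- The time mesh size `τ`, the largest length of a subinterval. -/
def size : ℝ := ⨆ n : Fin M.N, M.step n

/-- The trapezoidal (2-point Gauss-Lobatto) rule on the subinterval with number `n`, for functions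
that are continuous on the closed subinterval. -/
def trapezoidal (n : ℕ) (g : ℝ → ℝ) : ℝ := M.step n / 2 * (g (M.t n) + g (M.t (n + 1)))

end TimeMesh

section TimeSpaces

variable {B : Type} [NormedAddCommGroup B] [NormedSpace ℝ B] {T : ℝ}

/-- `w ∈ P_k(J; W)`: on `J`, `w` is a polynomial of degree at most `k` with coefficients in the
subspace `W`. -/
def IsPolyOn (k : ℕ) (J : Set ℝ) (W : Submodule ℝ B) (w : ℝ → B) : Prop :=
  ∃ c : ℕ → B, (∀ j, c j ∈ W) ∧ ∀ t ∈ J, w t = ∑ j ∈ Finset.range (k + 1), t ^ j • c j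

/-- `Y_τ^k(W)`: piecewise polynomials of degree at most `k` on the time mesh. -/
def Yspace (M : TimeMesh T) (k : ℕ) (W : Submodule ℝ B) : Set (ℝ → B) :=
  {w | ∀ n < M.N, IsPolyOn k (Ioc (M.t n) (M.t (n + 1))) W w}

/-- `X_τ^k(W)`: continuous piecewise polynomials of degree at most `k` on the time mesh. -/
def Xspace (M : TimeMesh T) (k : ℕ) (W : Submodule ℝ B) : Set (ℝ → B) :=
  {w | ContinuousOn w (Icc 0 T) ∧ w ∈ Yspace M k W}

end TimeSpaces

/-- `(u_{τ,h}, p_{τ,h}) ∈ X_τ^1(V_h) × Y_τ^1(Q_h)` solves the fully discrete problem on every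
subinterval, with initial value `u_{0,h}`. The test functions, piecewise constant in time, are
tested one subinterval at a time. -/
structure IsDiscreteSolution {T : ℝ} (M : TimeMesh T) (Vh : Submodule ℝ (H1 Ω))
    (Qh : Submodule ℝ (L2 Ω ℝ)) (f : ℝ → L2 Ω (E d)) (u₀h : H1 Ω)
    (uh : ℝ → H1 Ω) (ph : ℝ → L2 Ω ℝ) : Prop where
  velocity_mem : uh ∈ Xspace M 1 Vh
  pressure_mem : ph ∈ Yspace M 1 Qh
  initial : uh 0 = u₀h
  momentum : ∀ n < M.N, ∀ v ∈ Vh,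
    ∫ s in (M.t n)..(M.t (n + 1)),
        (⟪deriv (fun σ => toL2 (uh σ)) s, toL2 v⟫ + a (uh s) v + b v (ph s))
      = M.trapezoidal n (fun s => ⟪f s, toL2 v⟫)
  continuity : ∀ n < M.N, ∀ q ∈ Qh,
    ∫ s in (M.t n)..(M.t (n + 1)), b (uh s) q = 0

end StokesFEM

end

/-! The trapezoidal right-hand side turns the scheme into Crank–Nicolson for the nodal velocities.
The integral of an affine function sees only its midpoint value, so the discrete pressure enters
solely through its midpoint values (`IsDiscreteSolution.crankNicolson`). This is why they can be
estimated although the pressure itself is not unique.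

Let θ_m be the Stokes projection of the exact velocity at t_m minus the discrete velocity, and η_m
the mean of the projected pressures at the two nodes of a subinterval minus the discrete midpoint
pressure. The Stokes projection absorbs all terms in a and b at the nodes, so (θ, η) solves the same
scheme with a pure consistency error on the right (`IsDiscreteSolution.error_equation`). That error
is the trapezoidal defect, O(τ_m τ²), plus the projection error of the velocity increment. As the
projection is linear and the solution Lipschitz in time, the latter is O(τ_m h^r)
(`norm_consistency_error_le`).

Testing with the increments of θ, which are discretely divergence-free, removes the pressure and
bounds both ∑ ‖θ_{m+1} - θ_m‖²/τ_m and max ‖∇θ_m‖², without a Gronwall argument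
(`crankNicolson_energy`). The inf-sup condition bounds ‖η_m‖ by the difference quotient of θ, its
averaged gradient and the consistency error. Squared and weighted with τ_m, the quotients sum to
exactly the first controlled quantity, so no negative power of τ_m remains
(`crankNicolson_pressure`).

The pressure error is then η_m plus an O(τ²) interpolation error at the midpoint plus an O(h^r)
projection error, the latter by quasi-optimality (`norm_projection_error_le`). -/

namespace StokesFEM

/-! ### Abstract estimates: Stokes projection and Crank–Nicolson scheme. -/

section Abstract

variable {X H K P : Type*} [NormedAddCommGroup X] [NormedSpace ℝ X]
  [NormedAddCommGroup H] [InnerProductSpace ℝ H] [NormedAddCommGroup K] [InnerProductSpace ℝ K]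
  [NormedAddCommGroup P] [InnerProductSpace ℝ P]

/-- The inf-sup condition for the form `(v, q) ↦ -⟪D v, q⟫` in the form in which it is applied. -/
def InfSup (D : X →ₗ[ℝ] P) (Vh : Submodule ℝ X) (Qh : Submodule ℝ P) (β : ℝ) : Prop :=
  ∀ q ∈ Qh, ∀ L : ℝ, 0 ≤ L → (∀ v ∈ Vh, -⟪D v, q⟫ ≤ L * ‖v‖) → β * ‖q‖ ≤ L

/-- If x exceeded the bound, then A ≤ x, hence A + x ≤ 2x and the right-hand side is at most (1 +
2k)Ax < x². This closes the coupled velocity and pressure bounds of the projection error, with k =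
β⁻¹. -/
lemma le_of_sq_le_mul_add {x A k : ℝ} (hA : 0 ≤ A) (hk : 0 ≤ k)
    (h : x ^ 2 ≤ A * x + k * A * (A + x)) : x ≤ (1 + 2 * k) * A := by
  by_contra! hx
  have h1 : A ≤ x := by nlinarith [mul_nonneg hk hA]
  have h2 : 0 ≤ k * A * (x - A) := mul_nonneg (mul_nonneg hk hA) (by linarith)
  have hx0 : 0 < x := lt_of_le_of_lt (by positivity) hx
  nlinarith [mul_lt_mul_of_pos_right hx hx0]

/-- Quasi-optimality of the Stokes projection. -/
lemma norm_projection_error_le {G : X →ₗ[ℝ] K} {D : X →ₗ[ℝ] P} {Vh : Submodule ℝ X}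
    {Qh : Submodule ℝ P} {β cD : ℝ} (hβ : 0 < β) (hcD : 0 ≤ cD)
    (hG : ∀ v, ‖G v‖ ≤ ‖v‖) (hD : ∀ v, ‖D v‖ ≤ cD * ‖G v‖) (hIS : InfSup D Vh Qh β)
    {u z w : X} {p s q : P} (hz : z ∈ Vh) (hs : s ∈ Qh) (hw : w ∈ Vh) (hq : q ∈ Qh)
    (hmom : ∀ v ∈ Vh, ⟪G z, G v⟫ - ⟪D v, s⟫ = ⟪G u, G v⟫ - ⟪D v, p⟫)
    (hcont : ∀ q ∈ Qh, ⟪D z, q⟫ = 0) (hu : D u = 0) {ε : ℝ}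
    (h1 : ‖G (u - w)‖ ≤ ε) (h2 : ‖p - q‖ ≤ ε) :
    ‖G (u - z)‖ ≤ (1 + (1 + 2 * β⁻¹) * (1 + cD)) * ε ∧
      ‖p - s‖ ≤ (1 + β⁻¹ * (2 + 2 * β⁻¹) * (1 + cD)) * ε := by
  have hε : 0 ≤ ε := (norm_nonneg _).trans h1
  set A := (1 + cD) * ε with hA
  have hA0 : 0 ≤ A := by positivity
  have hm : ∀ v ∈ Vh, ⟪G (z - w), G v⟫ - ⟪D v, s - q⟫ = ⟪G (u - w), G v⟫ - ⟪D v, p - q⟫ := by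
    intro v hv
    have := hmom v hv
    simp only [map_sub, inner_sub_left, inner_sub_right]
    linarith
  have hy : β * ‖s - q‖ ≤ A + ‖G (z - w)‖ := by
    refine hIS _ (Qh.sub_mem hs hq) _ (by positivity) fun v hv => ?_
    have e := hm v hv
    have i1 : ⟪G (u - w), G v⟫ ≤ ε * ‖v‖ := (real_inner_le_norm _ _).trans
      (mul_le_mul h1 (hG v) (norm_nonneg _) hε)
    have i2 : -⟪G (z - w), G v⟫ ≤ ‖G (z - w)‖ * ‖v‖ :=
      (neg_le_abs _).trans ((abs_real_inner_le_norm _ _).trans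
        (mul_le_mul_of_nonneg_left (hG v) (norm_nonneg _)))
    have i3 : -⟪D v, p - q⟫ ≤ (cD * ‖v‖) * ε := (neg_le_abs _).trans
      ((abs_real_inner_le_norm _ _).trans (mul_le_mul ((hD v).trans
        (mul_le_mul_of_nonneg_left (hG v) hcD)) h2 (norm_nonneg _) (by positivity)))
    rw [hA]
    linarith
  have hy' : ‖s - q‖ ≤ β⁻¹ * (A + ‖G (z - w)‖) := by
    rw [inv_mul_eq_div, le_div_iff₀ hβ]; linarith
  have hx2 : ‖G (z - w)‖ ^ 2 ≤ A * ‖G (z - w)‖ + cD * ε * ‖s - q‖ := by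
    have e := hm (z - w) (Vh.sub_mem hz hw)
    rw [real_inner_self_eq_norm_sq] at e
    -- The approximant w need not be discretely divergence-free, so the pressure term survives.
    -- Discrete incompressibility of z and D u = 0 rewrite it with u - w, which is small.
    have e2 : ⟪D (z - w), s - q⟫ = ⟪D (u - w), s - q⟫ := by
      simp only [map_sub, hu, inner_sub_left, hcont _ (Qh.sub_mem hs hq), inner_zero_left]
    have i1 : ⟪G (u - w), G (z - w)⟫ ≤ ε * ‖G (z - w)‖ := (real_inner_le_norm _ _).trans
      (mul_le_mul_of_nonneg_right h1 (norm_nonneg _))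
    have i2 : ⟪D (u - w), s - q⟫ ≤ cD * ε * ‖s - q‖ := (real_inner_le_norm _ _).trans
      (mul_le_mul_of_nonneg_right ((hD _).trans (mul_le_mul_of_nonneg_left h1 hcD))
        (norm_nonneg _))
    have i3 : -⟪D (z - w), p - q⟫ ≤ (cD * ‖G (z - w)‖) * ε := (neg_le_abs _).trans
      ((abs_real_inner_le_norm _ _).trans (mul_le_mul (hD _) h2 (norm_nonneg _) (by positivity)))
    rw [hA]
    linarith
  have hx : ‖G (z - w)‖ ≤ (1 + 2 * β⁻¹) * A := by
    refine le_of_sq_le_mul_add hA0 (inv_nonneg.2 hβ.le) (hx2.trans ?_)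
    have : cD * ε * ‖s - q‖ ≤ A * (β⁻¹ * (A + ‖G (z - w)‖)) :=
      mul_le_mul (by rw [hA]; linarith) hy' (norm_nonneg _) hA0
    linarith
  constructor
  · have : G (u - z) = G (u - w) - G (z - w) := by simp
    rw [this]
    refine (norm_sub_le _ _).trans ?_
    rw [hA] at hx
    linarith
  · have : p - s = (p - q) - (s - q) := by abel
    rw [this]
    refine (norm_sub_le _ _).trans ?_
    have : β⁻¹ * (A + ‖G (z - w)‖) ≤ β⁻¹ * (A + (1 + 2 * β⁻¹) * A) := by gcongr
    rw [hA] at this hy'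
    linarith

/-- Energy estimate for the Crank–Nicolson scheme, tested with the increments. -/
lemma crankNicolson_energy {J : X →ₗ[ℝ] H} {G : X →ₗ[ℝ] K} {D : X →ₗ[ℝ] P}
    {Vh : Submodule ℝ X} {N : ℕ} {t : ℕ → ℝ} (ht : ∀ m < N, t m < t (m + 1))
    {θ : ℕ → X} {η : ℕ → P} {g : ℕ → H} {γ : ℝ}
    (hθ : ∀ m ≤ N, θ m ∈ Vh) (hdiv : ∀ m ≤ N, ∀ k < N, ⟪D (θ m), η k⟫ = 0)
    (hg : ∀ m < N, ‖g m‖ ≤ γ)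
    (heq : ∀ m < N, ∀ v ∈ Vh, ⟪J (θ (m + 1) - θ m), J v⟫
      + (t (m + 1) - t m) / 2 * ⟪G (θ m + θ (m + 1)), G v⟫
      - (t (m + 1) - t m) * ⟪D v, η m⟫ = (t (m + 1) - t m) * ⟪g m, J v⟫) :
    ∀ n ≤ N, (∑ m ∈ Finset.range n, ‖J (θ (m + 1) - θ m)‖ ^ 2 / (t (m + 1) - t m))
      + ‖G (θ n)‖ ^ 2 ≤ ‖G (θ 0)‖ ^ 2 + (t n - t 0) * γ ^ 2 := by
  intro n
  induction n with
  | zero => intro _; simp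
  | succ m ih =>
    intro hm
    have hm' : m < N := hm
    have ih := ih hm'.le
    have hτ : 0 < t (m + 1) - t m := sub_pos.2 (ht m hm')
    set τ := t (m + 1) - t m with hτd
    have e := heq m hm' (θ (m + 1) - θ m) (Vh.sub_mem (hθ _ hm) (hθ _ hm'.le))
    have e1 : ⟪D (θ (m + 1) - θ m), η m⟫ = 0 := by
      rw [map_sub, inner_sub_left, hdiv _ hm _ hm', hdiv _ hm'.le _ hm', sub_zero]
    -- Sum times difference: the elliptic term telescopes over the time levels.
    have e2 : ⟪G (θ m + θ (m + 1)), G (θ (m + 1) - θ m)⟫ = ‖G (θ (m + 1))‖ ^ 2 - ‖G (θ m)‖ ^ 2 := by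
      rw [map_add, map_sub, inner_add_left, inner_sub_right, inner_sub_right,
        real_inner_self_eq_norm_sq, real_inner_self_eq_norm_sq, real_inner_comm (G (θ m))]
      ring
    rw [e1, e2, real_inner_self_eq_norm_sq] at e
    have i1 : ⟪g m, J (θ (m + 1) - θ m)⟫ ≤ γ * ‖J (θ (m + 1) - θ m)‖ :=
      (real_inner_le_norm _ _).trans (mul_le_mul_of_nonneg_right (hg m hm') (norm_nonneg _))
    set x := ‖J (θ (m + 1) - θ m)‖
    -- Young's inequality τγx ≤ x²/2 + τ²γ²/2 keeps half of x²; the result is then multiplied by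
    -- 2/τ.
    have i2 : x ^ 2 / τ + ‖G (θ (m + 1))‖ ^ 2 - ‖G (θ m)‖ ^ 2 ≤ τ * γ ^ 2 := by
      have : x ^ 2 / τ * τ = x ^ 2 := div_mul_cancel₀ _ hτ.ne'
      have i3 := mul_le_mul_of_nonneg_left i1 hτ.le
      refine le_of_mul_le_mul_right ?_ hτ
      nlinarith [sq_nonneg (x - τ * γ)]
    rw [Finset.sum_range_succ]
    have : t (m + 1) - t 0 = (t m - t 0) + τ := by rw [hτd]; ring
    rw [this]
    linarith

/-- Pressure estimate for the Crank–Nicolson scheme. -/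
lemma crankNicolson_pressure {J : X →ₗ[ℝ] H} {G : X →ₗ[ℝ] K} {D : X →ₗ[ℝ] P}
    {Vh : Submodule ℝ X} {Qh : Submodule ℝ P} {β : ℝ} (hβ : 0 < β)
    (hJ : ∀ v, ‖J v‖ ≤ ‖v‖) (hG : ∀ v, ‖G v‖ ≤ ‖v‖) (hIS : InfSup D Vh Qh β)
    {N : ℕ} {T : ℝ} {t : ℕ → ℝ} (ht : ∀ m < N, t m < t (m + 1)) (ht0 : t 0 = 0)
    (htN : ∀ m ≤ N, t m ≤ T)
    {θ : ℕ → X} {η : ℕ → P} {g : ℕ → H} {γ : ℝ}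
    (hθ : ∀ m ≤ N, θ m ∈ Vh) (hη : ∀ m < N, η m ∈ Qh)
    (hdiv : ∀ m ≤ N, ∀ q ∈ Qh, ⟪D (θ m), q⟫ = 0)
    (hγ : 0 ≤ γ) (hg : ∀ m < N, ‖g m‖ ≤ γ)
    (heq : ∀ m < N, ∀ v ∈ Vh, ⟪J (θ (m + 1) - θ m), J v⟫
      + (t (m + 1) - t m) / 2 * ⟪G (θ m + θ (m + 1)), G v⟫
      - (t (m + 1) - t m) * ⟪D v, η m⟫ = (t (m + 1) - t m) * ⟪g m, J v⟫) :
    ∀ n ≤ N, ∑ m ∈ Finset.range n, (t (m + 1) - t m) * ‖η m‖ ^ 2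
      ≤ 3 * (β⁻¹) ^ 2 * (1 + T) * (‖G (θ 0)‖ ^ 2 + 2 * T * γ ^ 2) := by
  intro n hn
  have hen := crankNicolson_energy ht hθ (fun m hm k hk => hdiv m hm _ (hη k hk)) hg heq
  set S := ‖G (θ 0)‖ ^ 2 + T * γ ^ 2 with hS
  have hsum : ∀ k ≤ N, 0 ≤ ∑ m ∈ Finset.range k, ‖J (θ (m + 1) - θ m)‖ ^ 2 / (t (m + 1) - t m) :=
    fun k hk => Finset.sum_nonneg fun m hm =>
      div_nonneg (sq_nonneg _) (sub_pos.2 (ht m ((Finset.mem_range.1 hm).trans_le hk))).le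
  have hTk : ∀ k ≤ N, (t k - t 0) * γ ^ 2 ≤ T * γ ^ 2 := fun k hk =>
    mul_le_mul_of_nonneg_right (by have := htN k hk; linarith) (sq_nonneg _)
  have hT0 : 0 ≤ T := ht0 ▸ htN 0 (Nat.zero_le _)
  have hGS : ∀ k ≤ N, ‖G (θ k)‖ ^ 2 ≤ S := fun k hk => by
    have := hen k hk; have := hsum k hk; have := hTk k hk; rw [hS]; linarith
  have hS0 : 0 ≤ S := by positivity
  have hterm : ∀ m ∈ Finset.range n, (t (m + 1) - t m) * ‖η m‖ ^ 2 ≤ 3 * (β⁻¹) ^ 2 *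
      (‖J (θ (m + 1) - θ m)‖ ^ 2 / (t (m + 1) - t m) + (t (m + 1) - t m) * (γ ^ 2 + S)) := by
    intro m hm
    have hm : m < N := (Finset.mem_range.1 hm).trans_le hn
    have hτ : 0 < t (m + 1) - t m := sub_pos.2 (ht m hm)
    set τ := t (m + 1) - t m with hτd
    set x := ‖J (θ (m + 1) - θ m)‖ with hx
    set y := ‖G (θ m + θ (m + 1))‖ with hy
    have hy2 : (y / 2) ^ 2 ≤ S := by
      have h1 := hGS m hm.le
      have h2 := hGS (m + 1) hm
      have h3 : y ≤ ‖G (θ m)‖ + ‖G (θ (m + 1))‖ := by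
        rw [hy, map_add]; exact norm_add_le _ _
      have h4 : y ^ 2 ≤ (‖G (θ m)‖ + ‖G (θ (m + 1))‖) ^ 2 :=
        pow_le_pow_left₀ (norm_nonneg _) h3 2
      nlinarith [sq_nonneg (‖G (θ m)‖ - ‖G (θ (m + 1))‖)]
    -- The scheme divided by τ expresses the pressure functional through the other three terms;
    -- inf-sup turns this into a bound for η m.
    have h1 : β * ‖η m‖ ≤ γ + x / τ + y / 2 := by
      refine hIS _ (hη m hm) _ (by positivity) fun v hv => ?_
      have e := heq m hm v hv
      have i1 : ⟪g m, J v⟫ ≤ γ * ‖v‖ := (real_inner_le_norm _ _).trans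
        (mul_le_mul (hg m hm) (hJ v) (norm_nonneg _) hγ)
      have i2 : -⟪J (θ (m + 1) - θ m), J v⟫ ≤ x * ‖v‖ :=
        (neg_le_abs _).trans ((abs_real_inner_le_norm _ _).trans
          (mul_le_mul_of_nonneg_left (hJ v) (norm_nonneg _)))
      have i3 : -⟪G (θ m + θ (m + 1)), G v⟫ ≤ y * ‖v‖ :=
        (neg_le_abs _).trans ((abs_real_inner_le_norm _ _).trans
          (mul_le_mul_of_nonneg_left (hG v) (norm_nonneg _)))
      refine le_of_mul_le_mul_left ?_ hτ
      have e3 : τ * ((γ + x / τ + y / 2) * ‖v‖) = τ * (γ * ‖v‖) + x * ‖v‖ + τ / 2 * (y * ‖v‖) := by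
        field_simp
      rw [e3]
      have j1 := mul_le_mul_of_nonneg_left i1 hτ.le
      have j3 := mul_le_mul_of_nonneg_left i3 (half_pos hτ).le
      linarith
    have h2 : ‖η m‖ ≤ β⁻¹ * (γ + x / τ + y / 2) := by
      rw [inv_mul_eq_div, le_div_iff₀ hβ]; linarith
    have h3 : ‖η m‖ ^ 2 ≤ (β⁻¹) ^ 2 * (3 * (γ ^ 2 + (x / τ) ^ 2 + S)) := by
      refine (pow_le_pow_left₀ (norm_nonneg _) h2 2).trans ?_
      rw [mul_pow]
      refine mul_le_mul_of_nonneg_left ?_ (sq_nonneg _)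
      nlinarith [sq_nonneg (γ - x / τ), sq_nonneg (γ - y / 2), sq_nonneg (x / τ - y / 2)]
    refine (mul_le_mul_of_nonneg_left h3 hτ.le).trans (le_of_eq ?_)
    field_simp
    ring
  -- The terms x²/τ sum to at most S by the energy estimate, and the weights τ to at most T. The
  -- total S + T(γ² + S) is at most (1 + T)(‖G θ₀‖² + 2Tγ²), with T²γ² to spare.
  refine (Finset.sum_le_sum hterm).trans ?_
  rw [← Finset.mul_sum, Finset.sum_add_distrib, ← Finset.sum_mul, Finset.sum_range_sub,
    ht0, sub_zero, mul_assoc (3 * (β⁻¹) ^ 2)]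
  refine mul_le_mul_of_nonneg_left ?_ (by positivity)
  have h5 := hen n hn
  have h6 := hTk n hn
  have h7 : t n * (γ ^ 2 + S) ≤ T * (γ ^ 2 + S) :=
    mul_le_mul_of_nonneg_right (htN n hn) (by positivity)
  have h8 := sq_nonneg ‖G (θ n)‖
  have h9 : 0 ≤ T * (T * γ ^ 2) := by positivity
  rw [hS] at h7 ⊢
  nlinarith

end Abstract

end StokesFEM

namespace StokesFEM

/-! ### Quadrature and interpolation errors in time for vector-valued functions. -/

section TimeInterpolation

variable {B : Type*} [NormedAddCommGroup B] [NormedSpace ℝ B] {T : ℝ} {w : ℝ → B}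

lemma hasDerivWithinAt_of_contDiffOn {n : ℕ} (hn : n ≠ 0) (hw : ContDiffOn ℝ n w (Icc 0 T))
    {x : ℝ} (hx : x ∈ Icc 0 T) : HasDerivWithinAt w (derivWithin w (Icc 0 T) x) (Icc 0 T) x :=
  (hw.differentiableOn (by exact_mod_cast hn) x hx).hasDerivWithinAt

lemma contDiffOn_derivWithin_Icc (hT : 0 < T) {n : ℕ} (hw : ContDiffOn ℝ (n + 1 : ℕ) w (Icc 0 T)) :
    ContDiffOn ℝ n (derivWithin w (Icc 0 T)) (Icc 0 T) :=
  hw.derivWithin (uniqueDiffOn_Icc hT) (by norm_cast)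

lemma exists_norm_le_of_continuousOn {B : Type*} [NormedAddCommGroup B] {w : ℝ → B}
    (hw : ContinuousOn w (Icc 0 T)) :
    ∃ K, 0 ≤ K ∧ ∀ x ∈ Icc 0 T, ‖w x‖ ≤ K := by
  obtain ⟨K, hK⟩ := isCompact_Icc.exists_bound_of_continuousOn hw
  exact ⟨max K 0, le_max_right _ _, fun x hx => (hK x hx).trans (le_max_left _ _)⟩

lemma exists_lipschitz_of_contDiffOn (hT : 0 < T) (hw : ContDiffOn ℝ 1 w (Icc 0 T)) :
    ∃ K, 0 ≤ K ∧ ∀ x ∈ Icc 0 T, ∀ y ∈ Icc 0 T, ‖w y - w x‖ ≤ K * |y - x| := by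
  obtain ⟨K, hK0, hK⟩ := exists_norm_le_of_continuousOn
    (contDiffOn_derivWithin_Icc (n := 0) hT (by exact_mod_cast hw)).continuousOn
  exact ⟨K, hK0, fun x hx y hy => (convex_Icc 0 T).norm_image_sub_le_of_norm_hasDerivWithin_le
    (fun z hz => hasDerivWithinAt_of_contDiffOn (n := 1) one_ne_zero (by exact_mod_cast hw) hz)
    hK hx hy⟩

/-- The mean value inequality for z ↦ w z - z • w'(x), whose derivative w'(z) - w'(x) is at most K|y
- x| because w' is Lipschitz. The factor 1/2 is given away. -/
lemma exists_taylor_bound_of_contDiffOn (hT : 0 < T) (hw : ContDiffOn ℝ 2 w (Icc 0 T)) :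
    ∃ K, 0 ≤ K ∧ ∀ x ∈ Icc 0 T, ∀ y ∈ Icc 0 T,
      ‖w y - w x - (y - x) • derivWithin w (Icc 0 T) x‖ ≤ K * |y - x| ^ 2 := by
  obtain ⟨K, hK0, hK⟩ := exists_lipschitz_of_contDiffOn hT (w := derivWithin w (Icc 0 T))
    (by exact_mod_cast contDiffOn_derivWithin_Icc (n := 1) hT (by exact_mod_cast hw))
  refine ⟨K, hK0, fun x hx y hy => ?_⟩
  set a := derivWithin w (Icc 0 T) x
  have hsub : uIcc x y ⊆ Icc 0 T := OrdConnected.uIcc_subset ordConnected_Icc hx hy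
  have hd : ∀ z ∈ uIcc x y, HasDerivWithinAt (fun z => w z - z • a)
      (derivWithin w (Icc 0 T) z - (1 : ℝ) • a) (uIcc x y) z := fun z hz =>
    ((hasDerivWithinAt_of_contDiffOn (n := 2) two_ne_zero (by exact_mod_cast hw)
      (hsub hz)).mono hsub).sub ((hasDerivWithinAt_id z _).smul_const a)
  have := (convex_uIcc x y).norm_image_sub_le_of_norm_hasDerivWithin_le (C := K * |y - x|) hd
    (fun z hz => by
      rw [one_smul]
      exact (hK x hx z (hsub hz)).trans
        (mul_le_mul_of_nonneg_left (abs_sub_left_of_mem_uIcc hz) hK0))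
    left_mem_uIcc right_mem_uIcc
  rw [Real.norm_eq_abs] at this
  calc _ = ‖w y - y • a - (w x - x • a)‖ := by congr 1; rw [sub_smul]; abel
    _ ≤ _ := this
    _ = _ := by ring

/-- The error of the trapezoidal rule. -/
lemma exists_trapezoidal_error_le (hT : 0 < T) (hw : ContDiffOn ℝ 3 w (Icc 0 T)) :
    ∃ K, 0 ≤ K ∧ ∀ x ∈ Icc 0 T, ∀ y ∈ Icc 0 T,
      ‖w y - w x - ((y - x) / 2) • (derivWithin w (Icc 0 T) x + derivWithin w (Icc 0 T) y)‖
        ≤ K * |y - x| ^ 3 := by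
  have hw1 : ContDiffOn ℝ 2 (derivWithin w (Icc 0 T)) (Icc 0 T) := by
    exact_mod_cast contDiffOn_derivWithin_Icc (n := 2) hT (by exact_mod_cast hw)
  obtain ⟨K, hK0, hK⟩ := exists_taylor_bound_of_contDiffOn hT hw1
  set w' := derivWithin w (Icc 0 T)
  set w'' := derivWithin w' (Icc 0 T)
  refine ⟨K / 2, by positivity, fun x hx y hy => ?_⟩
  have hsub : uIcc x y ⊆ Icc 0 T := OrdConnected.uIcc_subset ordConnected_Icc hx hy
  -- The quadrature defect as a function of its right endpoint z. Its derivative is -1/2 times the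
  -- first-order Taylor remainder of w' about z, evaluated at x, hence of order |y - x|².
  have hd : ∀ z ∈ uIcc x y, HasDerivWithinAt (fun z => w z - ((z - x) / 2) • (w' x + w' z))
      (w' z - (((z - x) / 2) • w'' z + ((1 : ℝ) / 2) • (w' x + w' z))) (uIcc x y) z := fun z hz =>
    ((hasDerivWithinAt_of_contDiffOn (n := 3) three_ne_zero (by exact_mod_cast hw)
      (hsub hz)).mono hsub).sub ((((hasDerivWithinAt_id z _).sub_const x).div_const 2).smul
      (((hasDerivWithinAt_of_contDiffOn (n := 2) two_ne_zero (by exact_mod_cast hw1)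
        (hsub hz)).mono hsub).const_add (w' x)))
  have := (convex_uIcc x y).norm_image_sub_le_of_norm_hasDerivWithin_le (C := K / 2 * |y - x| ^ 2)
    hd (fun z hz => by
      have h1 := hK z (hsub hz) x hx
      have h2 : w' z - (((z - x) / 2) • w'' z + ((1 : ℝ) / 2) • (w' x + w' z))
          = (-(1 / 2) : ℝ) • (w' x - w' z - (x - z) • w'' z) := by module
      rw [h2, norm_smul]
      have h3 : |x - z| ^ 2 ≤ |y - x| ^ 2 := by
        rw [abs_sub_comm x z]
        exact pow_le_pow_left₀ (abs_nonneg _) (abs_sub_left_of_mem_uIcc hz) 2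
      have h4 := mul_le_mul_of_nonneg_left h3 hK0
      rw [show ‖(-(1 / 2) : ℝ)‖ = 1 / 2 by norm_num]
      linarith)
    left_mem_uIcc right_mem_uIcc
  rw [Real.norm_eq_abs] at this
  calc _ = ‖w y - ((y - x) / 2) • (w' x + w' y) - (w x - ((x - x) / 2) • (w' x + w' x))‖ := by
        congr 1; module
    _ ≤ _ := this
    _ = _ := by ring

/-- The error of the linear interpolant in the midpoint. -/
lemma exists_midpoint_error_le (hT : 0 < T) (hw : ContDiffOn ℝ 2 w (Icc 0 T)) :
    ∃ K, 0 ≤ K ∧ ∀ x ∈ Icc 0 T, ∀ y ∈ Icc 0 T,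
      ‖w ((x + y) / 2) - (1 / 2 : ℝ) • (w x + w y)‖ ≤ K * |y - x| ^ 2 := by
  obtain ⟨K, hK0, hK⟩ := exists_taylor_bound_of_contDiffOn hT hw
  refine ⟨K, hK0, fun x hx y hy => ?_⟩
  have hm : (x + y) / 2 ∈ Icc 0 T := ⟨by linarith [hx.1, hy.1], by linarith [hx.2, hy.2]⟩
  have h1 := hK _ hm x hx
  have h2 := hK _ hm y hy
  set m := (x + y) / 2 with hmd
  set a := derivWithin w (Icc 0 T) m
  -- Since x - m = -(y - m), the first-order Taylor terms about the midpoint cancel.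
  have e : w m - (1 / 2 : ℝ) • (w x + w y) =
      (-(1 / 2) : ℝ) • ((w x - w m - (x - m) • a) + (w y - w m - (y - m) • a)) := by
    rw [hmd]; module
  have e1 : |x - m| ^ 2 = |y - x| ^ 2 / 4 := by rw [sq_abs, sq_abs, hmd]; ring
  have e2 : |y - m| ^ 2 = |y - x| ^ 2 / 4 := by rw [sq_abs, sq_abs, hmd]; ring
  rw [e1] at h1
  rw [e2] at h2
  rw [e, norm_smul]
  have h3 := norm_add_le (w x - w m - (x - m) • a) (w y - w m - (y - m) • a)
  have h4 : 0 ≤ K * |y - x| ^ 2 := by positivity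
  rw [show ‖(-(1 / 2) : ℝ)‖ = 1 / 2 by norm_num]
  linarith

end TimeInterpolation

end StokesFEM

noncomputable section
namespace StokesFEM

variable {d : ℕ} {Ω : Set (E d)}

/-! ### The differential operators as bounded linear maps on H¹. -/

section Operators

variable {F : Type} [NormedAddCommGroup F] [InnerProductSpace ℝ F] {m : ℕ}

/-- A weak derivative, as a continuous linear map on `H^m`. -/
def weakDL (Ω : Set (E d)) (F : Type) [NormedAddCommGroup F] [InnerProductSpace ℝ F] {m : ℕ}
    (w : Word d m) : Sobolev Ω F m →L[ℝ] L2 Ω F :=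
  (PiLp.proj 2 (fun _ : Word d m => L2 Ω F) w).comp (Sobolev Ω F m).subtypeL

/-- The embedding of `H^m` into `L²`, as a continuous linear map. -/
def toL2L (Ω : Set (E d)) (F : Type) [NormedAddCommGroup F] [InnerProductSpace ℝ F] (m : ℕ) :
    Sobolev Ω F m →L[ℝ] L2 Ω F :=
  weakDL Ω F ⟨⟨0, Nat.succ_pos m⟩, Fin.elim0⟩

/-- A first order partial derivative, as a continuous linear map on `H^1`. -/
def pdL (Ω : Set (E d)) (F : Type) [NormedAddCommGroup F] [InnerProductSpace ℝ F] (i : Fin d) :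
    Sobolev Ω F 1 →L[ℝ] L2 Ω F :=
  weakDL Ω F ⟨⟨1, Nat.lt_succ_self 1⟩, fun _ => i⟩

lemma toL2L_apply (u : Sobolev Ω F m) : toL2L Ω F m u = toL2 u := rfl

lemma pdL_apply (i : Fin d) (u : Sobolev Ω F 1) : pdL Ω F i u = pd le_rfl i u := rfl

/-- The Jacobian, as a continuous linear map on `H^1(Ω)^d`. -/
def gradL (Ω : Set (E d)) : H1 Ω →L[ℝ] PiLp 2 (fun _ : Fin d => L2 Ω (E d)) :=
  (PiLp.continuousLinearEquiv 2 ℝ (fun _ : Fin d => L2 Ω (E d))).symm.toContinuousLinearMap.comp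
    (ContinuousLinearMap.pi fun i => pdL Ω (E d) i)

/-- The divergence, as a continuous linear map. -/
def divL (Ω : Set (E d)) : H1 Ω →L[ℝ] L2 Ω ℝ :=
  ∑ i : Fin d, (ContinuousLinearMap.compLpL 2 (volume.restrict Ω)
    (EuclideanSpace.proj i : E d →L[ℝ] ℝ)).comp (pdL Ω (E d) i)

lemma divL_apply (v : H1 Ω) : divL Ω v = divergence v := by
  simp only [divL, divergence, _root_.sum_apply]
  rfl

lemma a_eq_inner (u v : H1 Ω) : a u v = ⟪gradL Ω u, gradL Ω v⟫ := by
  rw [PiLp.inner_apply]; rfl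

lemma gradNormSq_eq (v : H1 Ω) : gradNormSq v = ‖gradL Ω v‖ ^ 2 := by
  rw [PiLp.norm_sq_eq_of_L2]; rfl

lemma gradNorm_eq (v : H1 Ω) : gradNorm v = ‖gradL Ω v‖ := by
  rw [gradNorm, gradNormSq_eq, Real.sqrt_sq (norm_nonneg _)]

lemma b_eq_inner (v : H1 Ω) (q : L2 Ω ℝ) : b v q = -⟪divL Ω v, q⟫ := by
  rw [divL_apply]; rfl

/-- The words of length at most one are the empty word, which contributes the function itself, and
the single letters, which contribute the Jacobian. -/
lemma norm_sq_eq (v : H1 Ω) : ‖v‖ ^ 2 = ‖toL2 v‖ ^ 2 + ‖gradL Ω v‖ ^ 2 := by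
  rw [← gradNormSq_eq, Submodule.coe_norm, PiLp.norm_sq_eq_of_L2, Fintype.sum_sigma,
    Fin.sum_univ_two]
  congr 1
  · exact Fintype.sum_unique (ι := Fin 0 → Fin d)
      (fun y => ‖v.1 ⟨(0 : Fin 2), y⟩‖ ^ 2) |>.trans (by
        rw [Subsingleton.elim (default : Fin 0 → Fin d) Fin.elim0]; rfl)
  · exact Fintype.sum_equiv (Equiv.funUnique (Fin 1) (Fin d)) _ _ fun y => by
      have : y = fun _ => y 0 := by
        funext j
        rw [Subsingleton.elim j 0]
      conv_lhs => rw [this]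
      rfl

lemma norm_toL2_le (v : H1 Ω) : ‖toL2 v‖ ≤ ‖v‖ :=
  abs_le_of_sq_le_sq' (by rw [norm_sq_eq v]; linarith [sq_nonneg ‖gradL Ω v‖]) (norm_nonneg _) |>.2

lemma norm_gradL_le (v : H1 Ω) : ‖gradL Ω v‖ ≤ ‖v‖ :=
  abs_le_of_sq_le_sq' (by rw [norm_sq_eq v]; linarith [sq_nonneg ‖toL2 v‖]) (norm_nonneg _) |>.2

lemma norm_pd_le (v : H1 Ω) (i : Fin d) : ‖pd le_rfl i v‖ ≤ ‖gradL Ω v‖ :=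
  PiLp.norm_apply_le (gradL Ω v) i

lemma norm_proj_le (i : Fin d) : ‖(EuclideanSpace.proj i : E d →L[ℝ] ℝ)‖ ≤ 1 :=
  ContinuousLinearMap.opNorm_le_bound _ zero_le_one fun x => by
    rw [one_mul]; exact PiLp.norm_apply_le x i

lemma norm_divL_le (v : H1 Ω) : ‖divL Ω v‖ ≤ d * ‖gradL Ω v‖ := by
  rw [divL_apply, divergence]
  refine (norm_sum_le_of_le (f := fun i => (EuclideanSpace.proj i : E d →L[ℝ] ℝ).compLp
    (pd le_rfl i v)) (n := fun _ => ‖gradL Ω v‖) Finset.univ fun i _ => ?_).trans ?_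
  · refine (ContinuousLinearMap.norm_compLp_le _ _).trans ?_
    calc _ ≤ 1 * ‖gradL Ω v‖ := mul_le_mul (norm_proj_le i) (norm_pd_le v i)
          (norm_nonneg _) zero_le_one
      _ = _ := one_mul _
  · simp

end Operators

/-! ### Calculus of weak derivatives. -/

section WeakDerivatives

lemma partialD_one (i : Fin d) (φ : E d → ℝ) (x : E d) :
    partialD (fun _ : Fin 1 => i) φ x = fderiv ℝ φ x (EuclideanSpace.single i 1) := by
  rw [partialD, iteratedFDeriv_one_apply]

lemma IsTestFunction.partialD_one {φ : E d → ℝ} (hφ : IsTestFunction Ω φ) (i : Fin d) :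
    IsTestFunction Ω (partialD (fun _ : Fin 1 => i) φ) := by
  have e : partialD (fun _ : Fin 1 => i) φ = fun x => fderiv ℝ φ x (EuclideanSpace.single i 1) :=
    funext (StokesFEM.partialD_one i φ)
  rw [e]
  have hs : tsupport (fun x => fderiv ℝ φ x (EuclideanSpace.single i 1)) ⊆ tsupport φ :=
    tsupport_fderiv_apply_subset ℝ _
  exact ⟨(hφ.smooth.fderiv_right (m := ∞) (by simp)).clm_apply contDiff_const,
    hφ.compactSupport.of_isClosed_subset (isClosed_tsupport _) hs, hs.trans hφ.support_subset⟩

lemma partialD_two (i : Fin d) {φ : E d → ℝ} (hφ : ContDiff ℝ ∞ φ) :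
    partialD (fun _ : Fin 2 => i) φ
      = partialD (fun _ : Fin 1 => i) (partialD (fun _ : Fin 1 => i) φ) := by
  funext x
  have e : partialD (fun _ : Fin 1 => i) φ = fun x => fderiv ℝ φ x (EuclideanSpace.single i 1) :=
    funext (partialD_one i φ)
  rw [partialD_one, e, partialD, iteratedFDeriv_two_apply]
  have hd : DifferentiableAt ℝ (fderiv ℝ φ) x :=
    ((hφ.fderiv_right (m := 1) (by norm_cast)).differentiable (by norm_num)) x
  rw [fderiv_clm_apply hd (differentiableAt_const _)]
  simp

variable {F : Type} [NormedAddCommGroup F] [InnerProductSpace ℝ F]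

/-- Insert ∂_i φ, again a test function, into the first-order relation and compare with the
second-order one. -/
lemma isWeakD_one_of_two {i : Fin d} {u v w : L2 Ω F}
    (h1 : IsWeakD (fun _ : Fin 1 => i) u v) (h2 : IsWeakD (fun _ : Fin 2 => i) u w) :
    IsWeakD (fun _ : Fin 1 => i) v w := by
  intro φ hφ
  have e1 := h1 _ (hφ.partialD_one i)
  have e2 := h2 φ hφ
  rw [partialD_two i hφ.smooth, e1] at e2
  simpa [neg_eq_iff_eq_neg] using e2

lemma IsWeakD.compLp [CompleteSpace F] {G : Type} [NormedAddCommGroup G] [InnerProductSpace ℝ G]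
    [CompleteSpace G] {k : ℕ} {w : Fin k → Fin d} {u v : L2 Ω F} (h : IsWeakD w u v)
    (A : F →L[ℝ] G) : IsWeakD w (A.compLp u) (A.compLp v) := by
  intro φ hφ
  have key : ∀ (ψ : E d → ℝ) (g : L2 Ω F), Integrable (fun x => ψ x • (g x : F))
      (volume.restrict Ω) → ∫ x in Ω, ψ x • (A.compLp g x : G)
        = A (∫ x in Ω, ψ x • (g x : F)) := by
    intro ψ g hg
    rw [← A.integral_comp_comm hg]
    refine integral_congr_ae ((A.coeFn_compLp g).mono fun x hx => ?_)
    simp only [hx, map_smul]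
  rw [key _ _ (integrable_partialD_smul hφ w u), key _ _ (integrable_smul hφ v), h φ hφ, map_smul]

end WeakDerivatives

/-! ### Test fields, density in H¹₀, and integration by parts. -/

section TestFields

lemma IsTestFunction.add {F : Type} [NormedAddCommGroup F] [NormedSpace ℝ F] {φ ψ : E d → F}
    (hφ : IsTestFunction Ω φ) (hψ : IsTestFunction Ω ψ) : IsTestFunction Ω (φ + ψ) :=
  ⟨hφ.smooth.add hψ.smooth, hφ.compactSupport.add hψ.compactSupport,
    (tsupport_add φ ψ).trans (union_subset hφ.support_subset hψ.support_subset)⟩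

lemma IsTestFunction.const_smul {F : Type} [NormedAddCommGroup F] [NormedSpace ℝ F] {φ : E d → F}
    (hφ : IsTestFunction Ω φ) (c : ℝ) : IsTestFunction Ω (c • φ) := by
  have hs : tsupport (c • φ) ⊆ tsupport φ := closure_mono (Function.support_const_smul_subset c φ)
  exact ⟨hφ.smooth.const_smul c, hφ.compactSupport.of_isClosed_subset (isClosed_tsupport _) hs,
    hs.trans hφ.support_subset⟩

lemma isTestFunction_zero {F : Type} [NormedAddCommGroup F] [NormedSpace ℝ F] :
    IsTestFunction Ω (0 : E d → F) :=
  ⟨contDiff_const, HasCompactSupport.zero, by simp [tsupport]⟩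

lemma IsTestFunction.component {φ : E d → E d} (hφ : IsTestFunction Ω φ) (j : Fin d) :
    IsTestFunction Ω (fun x => φ x j) := by
  have hs : tsupport (fun x => φ x j) ⊆ tsupport φ :=
    closure_mono fun x hx h0 => hx (by simp [h0])
  exact ⟨(EuclideanSpace.proj j : E d →L[ℝ] ℝ).contDiff.comp hφ.smooth,
    hφ.compactSupport.of_isClosed_subset (isClosed_tsupport _) hs, hs.trans hφ.support_subset⟩

lemma partialD_component {φ : E d → E d} (hφ : IsTestFunction Ω φ) (i j : Fin d) (x : E d) :
    partialD (fun _ : Fin 1 => i) (fun x => φ x j) x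
      = (fderiv ℝ φ x (EuclideanSpace.single i 1)) j := by
  rw [partialD_one]
  have hd : DifferentiableAt ℝ φ x := hφ.smooth.differentiable (by simp) x
  have := ((EuclideanSpace.proj j : E d →L[ℝ] ℝ).hasFDerivAt.comp x hd.hasFDerivAt).fderiv
  exact congrArg (fun A : E d →L[ℝ] ℝ => A (EuclideanSpace.single i 1)) this

/-- An induction principle for `H^1_0`. -/
lemma V_induction {p : H1 Ω → Prop} (hcl : IsClosed {v | p v})
    (htest : ∀ v : H1 Ω, ∀ φ : E d → E d, IsTestFunction Ω φ →
      (toL2 v : E d → E d) =ᵐ[volume.restrict Ω] φ → p v) {v : H1 Ω} (hv : v ∈ V Ω) : p v := by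
  -- Test fields already form a subspace, so every element of the span is itself represented by one
  -- test field.
  have hspan : ∀ v ∈ Submodule.span ℝ {v : H1 Ω | ∃ φ : E d → E d, IsTestFunction Ω φ ∧
      (toL2 v : E d → E d) =ᵐ[volume.restrict Ω] φ}, ∃ φ : E d → E d, IsTestFunction Ω φ ∧
      (toL2 v : E d → E d) =ᵐ[volume.restrict Ω] φ := by
    intro v hv
    induction hv using Submodule.span_induction with
    | mem v hv => exact hv
    | zero =>
      refine ⟨0, isTestFunction_zero, ?_⟩
      rw [← toL2L_apply, map_zero]
      exact Lp.coeFn_zero _ _ _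
    | add v w _ _ hv hw =>
      obtain ⟨φ, hφ, e⟩ := hv
      obtain ⟨ψ, hψ, e'⟩ := hw
      refine ⟨φ + ψ, hφ.add hψ, ?_⟩
      rw [← toL2L_apply, map_add]
      exact (Lp.coeFn_add _ _).trans (e.add e')
    | smul c v _ hv =>
      obtain ⟨φ, hφ, e⟩ := hv
      refine ⟨c • φ, hφ.const_smul c, ?_⟩
      rw [← toL2L_apply, map_smul]
      exact (Lp.coeFn_smul _ _).trans (e.const_smul c)
  refine closure_minimal (t := {v | p v}) ?_ hcl hv
  intro v hv
  obtain ⟨φ, hφ, e⟩ := hspan v hv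
  exact htest v φ hφ e

lemma IsTestFunction.continuous_fderiv_apply {φ : E d → E d} (hφ : IsTestFunction Ω φ) (e : E d) :
    Continuous fun x => fderiv ℝ φ x e :=
  (hφ.smooth.continuous_fderiv (by simp)).clm_apply continuous_const

lemma IsTestFunction.hasCompactSupport_fderiv_apply {φ : E d → E d} (hφ : IsTestFunction Ω φ)
    (e : E d) : HasCompactSupport fun x => fderiv ℝ φ x e :=
  hφ.compactSupport.fderiv_apply ℝ e

/-- The weak derivative of a test field is its classical derivative. -/
lemma pd_ae_eq_fderiv (hΩ : IsOpen Ω) (hΩb : Bornology.IsBounded Ω) {v : H1 Ω} {φ : E d → E d}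
    (hφ : IsTestFunction Ω φ) (hv : (toL2 v : E d → E d) =ᵐ[volume.restrict Ω] φ) (i : Fin d) :
    (pd le_rfl i v : E d → E d) =ᵐ[volume.restrict Ω]
      fun x => fderiv ℝ φ x (EuclideanSpace.single i 1) := by
  set e : E d := EuclideanSpace.single i 1 with he
  have hfin : IsFiniteMeasure (volume.restrict Ω) := ⟨by
    rw [Measure.restrict_apply_univ]; exact hΩb.measure_lt_top⟩
  have hi1 : Integrable (pd le_rfl i v : E d → E d) (volume.restrict Ω) :=
    (Lp.memLp (pd le_rfl i v)).integrable (by norm_num)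
  have hc := hφ.continuous_fderiv_apply e
  have hi2 : Integrable (fun x => fderiv ℝ φ x e) (volume.restrict Ω) :=
    (hc.integrable_of_hasCompactSupport (hφ.hasCompactSupport_fderiv_apply e)).restrict
  -- Fundamental lemma of the calculus of variations, applied to the difference of the weak and the
  -- classical derivative.
  have key := hΩ.ae_eq_zero_of_integral_contDiff_smul_eq_zero (μ := volume)
    (f := fun x => (pd le_rfl i v : E d → E d) x - fderiv ℝ φ x e)
    (IntegrableOn.locallyIntegrableOn (hi1.sub hi2)) (by
      intro ψ hψ hψc hψs
      have hψt : IsTestFunction Ω ψ := ⟨hψ, hψc, hψs⟩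
      have hz : ∀ x ∉ Ω, ψ x = 0 := fun x hx => image_eq_zero_of_notMem_tsupport fun h => hx (hψs h)
      have hz' : ∀ x ∉ Ω, fderiv ℝ ψ x e = 0 := fun x hx => by
        rw [fderiv_of_notMem_tsupport (𝕜 := ℝ) fun h => hx (hψs h)]; rfl
      rw [← setIntegral_eq_integral_of_forall_compl_eq_zero (s := Ω)
        (fun x hx => by rw [hz x hx, zero_smul])]
      simp_rw [smul_sub]
      have hcψ : Continuous fun x => fderiv ℝ ψ x e :=
        (hψ.continuous_fderiv (by simp)).clm_apply continuous_const
      have j1 : Integrable (fun x => ψ x • fderiv ℝ φ x e) volume :=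
        (hψ.continuous.smul hc).integrable_of_hasCompactSupport hψc.smul_right
      have j2 : Integrable (fun x => fderiv ℝ ψ x e • φ x) volume :=
        (hcψ.smul hφ.smooth.continuous).integrable_of_hasCompactSupport
          (hψc.fderiv_apply ℝ e).smul_right
      have j3 : Integrable (fun x => ψ x • φ x) volume :=
        (hψ.continuous.smul hφ.smooth.continuous).integrable_of_hasCompactSupport hψc.smul_right
      rw [integral_sub (integrable_smul hψt _) j1.restrict]
      -- Both integrands vanish outside Ω, so classical integration by parts on the whole space
      -- applies and no boundary regularity is needed.
      have e1 : ∫ x in Ω, ψ x • fderiv ℝ φ x e = - ∫ x in Ω, fderiv ℝ ψ x e • φ x := by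
        rw [setIntegral_eq_integral_of_forall_compl_eq_zero
          (fun x hx => by rw [hz x hx, zero_smul]),
          setIntegral_eq_integral_of_forall_compl_eq_zero
          (fun x hx => by rw [hz' x hx, zero_smul])]
        exact integral_smul_fderiv_eq_neg_fderiv_smul_of_integrable j2 j1 j3
          (fun x _ => hψ.differentiable (by simp) x)
          (fun x _ => hφ.smooth.differentiable (by simp) x)
      have e2 := v.2 ⟨⟨1, Nat.lt_succ_self 1⟩, fun _ => i⟩ ψ hψt
      have e3 : ∫ x in Ω, partialD (fun _ : Fin 1 => i) ψ x • (toL2 v x : E d)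
          = ∫ x in Ω, fderiv ℝ ψ x e • φ x := by
        refine integral_congr_ae (hv.mono fun x hx => ?_)
        simp only [hx, partialD_one, he]
      have e4 : ∫ x in Ω, partialD (fun _ : Fin 1 => i) ψ x • (toL2 v x : E d)
          = (-1 : ℝ) ^ 1 • ∫ x in Ω, ψ x • (pd le_rfl i v x : E d) := e2
      rw [e1, ← e3, e4]
      simp)
  have := (ae_restrict_iff' hΩ.measurableSet).2 key
  exact this.mono fun x hx => sub_eq_zero.1 hx

/-- Weak derivatives are defined with scalar test functions and vector-valued integrals. Splitting
the inner product into components reduces a vector test field to that setting. -/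
lemma integral_inner_eq_sum {g ψ : E d → E d} {μ : Measure (E d)}
    (h : ∀ j, Integrable (fun x => ψ x j • g x) μ) :
    ∫ x, ⟪g x, ψ x⟫ ∂μ = ∑ j, (∫ x, ψ x j • g x ∂μ) j := by
  have e : ∀ j, (∫ x, ψ x j • g x ∂μ) j = ∫ x, ψ x j * g x j ∂μ := fun j =>
    ((EuclideanSpace.proj j : E d →L[ℝ] ℝ).integral_comp_comm (h j)).symm
  simp_rw [e]
  rw [← integral_finsetSum]
  · refine integral_congr_ae (Filter.Eventually.of_forall fun x => ?_)
    simp [PiLp.inner_apply]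
  · exact fun j _ => (EuclideanSpace.proj j : E d →L[ℝ] ℝ).integrable_comp (h j)

/-- Integration by parts against a field in `H^1_0`. -/
lemma inner_weakD_eq_neg (hΩ : IsOpen Ω) (hΩb : Bornology.IsBounded Ω) {i : Fin d}
    {g h : L2 Ω (E d)} (hgh : IsWeakD (fun _ : Fin 1 => i) g h) {v : H1 Ω} (hv : v ∈ V Ω) :
    ⟪h, toL2 v⟫ = -⟪g, pd le_rfl i v⟫ := by
  refine V_induction (p := fun v => ⟪h, toL2L Ω (E d) 1 v⟫ = -⟪g, pdL Ω (E d) i v⟫)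
    (isClosed_eq (by fun_prop) (by fun_prop)) ?_ hv
  intro v φ hφ hvφ
  rw [toL2L_apply, pdL_apply, L2.inner_def, L2.inner_def]
  have e1 : ∫ x in Ω, ⟪(h x : E d), (toL2 v x : E d)⟫ = ∫ x in Ω, ⟪(h x : E d), φ x⟫ :=
    integral_congr_ae (hvφ.mono fun x hx => by simp only [hx])
  have e2 : ∫ x in Ω, ⟪(g x : E d), (pd le_rfl i v x : E d)⟫
      = ∫ x in Ω, ⟪(g x : E d), fderiv ℝ φ x (EuclideanSpace.single i 1)⟫ :=
    integral_congr_ae ((pd_ae_eq_fderiv hΩ hΩb hφ hvφ i).mono fun x hx => by simp only [hx])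
  rw [e1, e2, integral_inner_eq_sum (fun j => integrable_smul (hφ.component j) h),
    integral_inner_eq_sum (fun j => by
      simpa only [partialD_component hφ] using
        integrable_partialD_smul (hφ.component j) (fun _ : Fin 1 => i) g), ← Finset.sum_neg_distrib]
  refine Finset.sum_congr rfl fun j _ => ?_
  have := hgh _ (hφ.component j)
  simp only [partialD_component hφ] at this
  rw [this]
  simp

end TestFields

end StokesFEM
end

noncomputable section
namespace StokesFEM

variable {d : ℕ} {Ω : Set (E d)}

/-! ### Poincaré inequality and weak form of the momentum equation. -/

section IntegrationByParts

lemma norm_sq_eq_integral_of_ae_eq {F : Type} [NormedAddCommGroup F] [InnerProductSpace ℝ F]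
    {v : L2 Ω F} {φ : E d → F} (h : (v : E d → F) =ᵐ[volume.restrict Ω] φ)
    (h0 : ∀ x ∉ Ω, φ x = 0) : ‖v‖ ^ 2 = ∫ x, ‖φ x‖ ^ 2 := by
  rw [← real_inner_self_eq_norm_sq, L2.inner_def,
    ← setIntegral_eq_integral_of_forall_compl_eq_zero (s := Ω) (f := fun x => ‖φ x‖ ^ 2)
      (fun x hx => by simp [h0 x hx])]
  exact integral_congr_ae (h.mono fun x hx => by simp only [hx, real_inner_self_eq_norm_sq])

lemma integrable_norm_sq {φ : E d → E d} (hc : Continuous φ) (hs : HasCompactSupport φ) :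
    Integrable fun x => ‖φ x‖ ^ 2 := by
  have h1 : Continuous fun x => ‖φ x‖ ^ 2 := by fun_prop
  have h2 : HasCompactSupport fun x => ‖φ x‖ ^ 2 :=
    hs.comp_left (g := fun y : E d => ‖y‖ ^ 2) (by simp)
  exact h1.integrable_of_hasCompactSupport h2

/-- Write ‖φ‖² = (∂_i x_i)‖φ‖² and integrate by parts. -/
lemma IsTestFunction.integral_norm_sq {φ : E d → E d} (hφ : IsTestFunction Ω φ) (i : Fin d) :
    Integrable (fun x => x i * ⟪φ x, fderiv ℝ φ x (EuclideanSpace.single i 1)⟫) ∧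
    ∫ x, ‖φ x‖ ^ 2
      = -2 * ∫ x, x i * ⟪φ x, fderiv ℝ φ x (EuclideanSpace.single i 1)⟫ := by
  set e : E d := EuclideanSpace.single i 1 with he
  have hφc := hφ.smooth.continuous
  have hc := hφ.continuous_fderiv_apply e
  have hd : Differentiable ℝ φ := hφ.smooth.differentiable (by simp)
  have hs2 : HasCompactSupport fun x => ‖φ x‖ ^ 2 :=
    hφ.compactSupport.comp_left (g := fun y : E d => ‖y‖ ^ 2) (by simp)
  have j1 := integrable_norm_sq hφc hφ.compactSupport
  have hPc : Continuous fun x : E d => x i := (EuclideanSpace.proj i : E d →L[ℝ] ℝ).continuous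
  have hPd : ∀ x : E d, HasFDerivAt (fun x : E d => x i) (EuclideanSpace.proj i : E d →L[ℝ] ℝ) x :=
    fun x => (EuclideanSpace.proj i : E d →L[ℝ] ℝ).hasFDerivAt
  have hP1 : ∀ x, fderiv ℝ (fun x : E d => x i) x e = 1 := fun x => by
    rw [(hPd x).fderiv, he]; simp
  have hf2 : ∀ x, fderiv ℝ (fun x => ‖φ x‖ ^ 2) x e = 2 * ⟪φ x, fderiv ℝ φ x e⟫ := fun x => by
    rw [((hd x).hasFDerivAt.norm_sq).fderiv]
    simp
  have j0 : Integrable fun x => x i * ⟪φ x, fderiv ℝ φ x e⟫ := by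
    refine Continuous.integrable_of_hasCompactSupport (hPc.mul (hφc.inner hc)) ?_
    refine (hφ.compactSupport.mono' (f' := fun x => ⟪φ x, fderiv ℝ φ x e⟫) ?_).mul_left
    intro x hx
    by_contra h
    exact hx (by simp [image_eq_zero_of_notMem_tsupport h])
  have j3 : Integrable fun x => x i * fderiv ℝ (fun x => ‖φ x‖ ^ 2) x e := by
    simp_rw [hf2]
    exact (j0.const_mul 2).congr (Filter.Eventually.of_forall fun x => by ring)
  have j4 : Integrable fun x => x i * ‖φ x‖ ^ 2 :=
    (hPc.mul (hφc.norm.pow 2)).integrable_of_hasCompactSupport hs2.mul_left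
  have ibp := integral_mul_fderiv_eq_neg_fderiv_mul_of_integrable (μ := (volume : Measure (E d)))
    (f := fun x => x i) (g := fun x => ‖φ x‖ ^ 2) (v := e)
    (by simpa only [hP1, one_mul] using j1) j3 j4
    (fun x _ => (hPd x).differentiableAt) (fun x _ => (hd x).norm_sq ℝ)
  simp only [hP1, one_mul, hf2] at ibp
  refine ⟨j0, ?_⟩
  rw [← neg_eq_iff_eq_neg.2 ibp, neg_mul, ← integral_const_mul]
  congr 2
  funext x
  ring

lemma neg_two_mul_le {s R x y : ℝ} (h : |s| ≤ R * (x * y)) :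
    -2 * s ≤ 1 / 2 * x ^ 2 + 2 * R ^ 2 * y ^ 2 := by
  have h4 := neg_le_abs s
  linarith [sq_nonneg (x - 2 * (R * y))]

/-- The Poincaré inequality for one test field. -/
lemma integral_norm_sq_le {R : ℝ} (hR : ∀ x ∈ Ω, ‖x‖ ≤ R) {φ : E d → E d}
    (hφ : IsTestFunction Ω φ) (i : Fin d) :
    ∫ x, ‖φ x‖ ^ 2 ≤ (2 * R) ^ 2 * ∫ x, ‖fderiv ℝ φ x (EuclideanSpace.single i 1)‖ ^ 2 := by
  obtain ⟨j0, ibp⟩ := hφ.integral_norm_sq i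
  have hc := hφ.continuous_fderiv_apply (EuclideanSpace.single i 1)
  have hcs := hφ.hasCompactSupport_fderiv_apply (EuclideanSpace.single i 1)
  have hz : ∀ x ∉ Ω, φ x = 0 := fun x hx =>
    image_eq_zero_of_notMem_tsupport fun h => hx (hφ.support_subset h)
  have j1 := integrable_norm_sq hφ.smooth.continuous hφ.compactSupport
  set ψ : E d → E d := fun x => fderiv ℝ φ x (EuclideanSpace.single i 1) with hψ
  have j2 : Integrable fun x => ‖ψ x‖ ^ 2 := integrable_norm_sq hc hcs
  have hle : ∫ x, (-2) * (x i * ⟪φ x, ψ x⟫)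
      ≤ ∫ x, ((1 / 2) * ‖φ x‖ ^ 2 + 2 * R ^ 2 * ‖ψ x‖ ^ 2) := by
    have k1 : Integrable fun x => (-2) * (x i * ⟪φ x, ψ x⟫) := j0.const_mul _
    have k2 : Integrable fun x => (1 / 2) * ‖φ x‖ ^ 2 + 2 * R ^ 2 * ‖ψ x‖ ^ 2 :=
      (j1.const_mul _).add (j2.const_mul _)
    refine integral_mono k1 k2 fun x => ?_
    dsimp only
    by_cases hx : x ∈ Ω
    · have h1 : |x i| ≤ R := (PiLp.norm_apply_le x i).trans (hR x hx)
      have h2 := abs_real_inner_le_norm (φ x) (ψ x)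
      have h3 : |x i * ⟪φ x, ψ x⟫| ≤ R * (‖φ x‖ * ‖ψ x‖) := by
        rw [abs_mul]
        exact mul_le_mul h1 h2 (abs_nonneg _) ((abs_nonneg _).trans h1)
      exact neg_two_mul_le h3
    · rw [hz x hx]
      simp only [inner_zero_left, mul_zero, norm_zero]
      positivity
  -- Half of the integral of ‖φ‖² is absorbed on the left; doubling 2R² gives the constant (2R)².
  rw [integral_const_mul, ← ibp, integral_add (j1.const_mul _) (j2.const_mul _),
    integral_const_mul, integral_const_mul] at hle
  linarith

/-- The Poincaré inequality. -/
lemma norm_toL2_le_of_mem_V (hΩ : IsOpen Ω) (hΩb : Bornology.IsBounded Ω) {R : ℝ} (hR0 : 0 ≤ R)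
    (hR : ∀ x ∈ Ω, ‖x‖ ≤ R) (i : Fin d) {v : H1 Ω} (hv : v ∈ V Ω) :
    ‖toL2 v‖ ≤ 2 * R * ‖pd le_rfl i v‖ := by
  refine V_induction (p := fun v => ‖toL2L Ω (E d) 1 v‖ ≤ 2 * R * ‖pdL Ω (E d) i v‖)
    (isClosed_le (by fun_prop) (by fun_prop)) ?_ hv
  intro v φ hφ hvφ
  rw [toL2L_apply, pdL_apply]
  refine abs_le_of_sq_le_sq' ?_ (by positivity) |>.2
  have hn : ∀ x ∉ Ω, x ∉ tsupport φ := fun x hx h => hx (hφ.support_subset h)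
  rw [mul_pow, norm_sq_eq_integral_of_ae_eq hvφ
      fun x hx => image_eq_zero_of_notMem_tsupport (hn x hx),
    norm_sq_eq_integral_of_ae_eq (pd_ae_eq_fderiv hΩ hΩb hφ hvφ i)
      fun x hx => by rw [fderiv_of_notMem_tsupport (𝕜 := ℝ) (hn x hx)]; rfl]
  exact integral_norm_sq_le hR hφ i

lemma inner_laplacian (hΩ : IsOpen Ω) (hΩb : Bornology.IsBounded Ω) {m : ℕ} (hm : 2 ≤ m)
    (u : Sobolev Ω (E d) m) {v : H1 Ω} (hv : v ∈ V Ω) :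
    ⟪laplacian hm u, toL2 v⟫ = -a (toH1 (one_le_two.trans hm) u) v := by
  rw [laplacian, sum_inner, a, ← Finset.sum_neg_distrib]
  refine Finset.sum_congr rfl fun i _ => inner_weakD_eq_neg hΩ hΩb ?_ hv
  exact isWeakD_one_of_two
    (u.2 ⟨⟨1, Nat.lt_succ_of_le (one_le_two.trans hm)⟩, fun _ => i⟩)
    (u.2 ⟨⟨2, Nat.lt_succ_of_le hm⟩, fun _ => i⟩)

lemma inner_compLp_toSpanSingleton (i : Fin d) (q : L2 Ω ℝ) (w : L2 Ω (E d)) :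
    ⟪(ContinuousLinearMap.toSpanSingleton ℝ
      (EuclideanSpace.single i (1 : ℝ) : E d)).compLp q, w⟫
      = ⟪q, (EuclideanSpace.proj i : E d →L[ℝ] ℝ).compLp w⟫ := by
  rw [L2.inner_def, L2.inner_def]
  refine integral_congr_ae ?_
  filter_upwards [ContinuousLinearMap.coeFn_compLp (ContinuousLinearMap.toSpanSingleton ℝ
      (EuclideanSpace.single i (1 : ℝ) : E d)) q,
    ContinuousLinearMap.coeFn_compLp (EuclideanSpace.proj i : E d →L[ℝ] ℝ) w] with x h1 h2
  rw [h1, h2, ContinuousLinearMap.toSpanSingleton_apply, real_inner_smul_left,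
    EuclideanSpace.inner_single_left]
  simp [mul_comm]

/-- Integration by parts is applied to the vector fields q e_i, whose weak i-th derivatives (∂_i q)
e_i add up to the gradient. -/
lemma inner_gradient (hΩ : IsOpen Ω) (hΩb : Bornology.IsBounded Ω) {m : ℕ} (hm : 1 ≤ m)
    (q : Sobolev Ω ℝ m) {v : H1 Ω} (hv : v ∈ V Ω) :
    ⟪gradient hm q, toL2 v⟫ = b v (toL2 q) := by
  rw [gradient, sum_inner, b, divergence, sum_inner, ← Finset.sum_neg_distrib]
  refine Finset.sum_congr rfl fun i _ => ?_
  have h : IsWeakD (fun _ : Fin 1 => i) (toL2 q) (pd hm i q) :=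
    q.2 ⟨⟨1, Nat.lt_succ_of_le hm⟩, fun _ => i⟩
  rw [inner_weakD_eq_neg hΩ hΩb (h.compLp _) hv, inner_compLp_toSpanSingleton, real_inner_comm]

/-- The weak form of the momentum equation. -/
lemma IsStokesSolution.weak_momentum (hΩ : IsOpen Ω) (hΩb : Bornology.IsBounded Ω) {T : ℝ}
    {f : ℝ → L2 Ω (E d)} {u₀ : L2 Ω (E d)} {r : ℕ} {hr : 1 ≤ r}
    {u : ℝ → Sobolev Ω (E d) (r + 1)} {p : ℝ → Sobolev Ω ℝ r}
    (hsol : IsStokesSolution T f u₀ hr u p) {t : ℝ} (ht : t ∈ Icc 0 T) {v : H1 Ω} (hv : v ∈ V Ω) :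
    ⟪derivWithin (fun s => toL2 (u s)) (Icc 0 T) t, toL2 v⟫
      + a (toH1 (Nat.le_add_left 1 r) (u t)) v + b v (toL2 (p t)) = ⟪f t, toL2 v⟫ := by
  rw [← hsol.momentum t ht, inner_add_left, inner_sub_left, inner_laplacian hΩ hΩb _ _ hv,
    inner_gradient hΩ hΩb _ _ hv]
  ring

end IntegrationByParts

end StokesFEM
end

noncomputable section
namespace StokesFEM

/-! ### Solvability of the discrete saddle point problem. -/

section AbstractProjection

variable {X K P : Type*} [NormedAddCommGroup X] [NormedSpace ℝ X]
  [NormedAddCommGroup K] [InnerProductSpace ℝ K] [NormedAddCommGroup P] [InnerProductSpace ℝ P]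

/-- Solvability of the discrete Stokes problem. -/
lemma exists_saddlePoint {G : X →ₗ[ℝ] K} {D : X →ₗ[ℝ] P} {Vh : Submodule ℝ X}
    {Qh : Submodule ℝ P} [FiniteDimensional ℝ Vh] [FiniteDimensional ℝ Qh] {β : ℝ} (hβ : 0 < β)
    (hG0 : ∀ v ∈ Vh, G v = 0 → v = 0) (hIS : InfSup D Vh Qh β) (u : X) (p : P) :
    ∃ z ∈ Vh, ∃ s ∈ Qh, (∀ v ∈ Vh, ⟪G z, G v⟫ - ⟪D v, s⟫ = ⟪G u, G v⟫ - ⟪D v, p⟫) ∧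
      ∀ q ∈ Qh, ⟪D z, q⟫ = 0 := by
  let GV : Vh →ₗ[ℝ] K := G ∘ₗ Vh.subtype
  let DV : Vh →ₗ[ℝ] P := D ∘ₗ Vh.subtype
  let A : Vh →ₗ[ℝ] Module.Dual ℝ Vh := (innerₗ K).compl₁₂ GV GV
  let B : Qh →ₗ[ℝ] Module.Dual ℝ Vh := (innerₗ P).compl₁₂ Qh.subtype DV
  let C : Vh →ₗ[ℝ] Module.Dual ℝ Qh := (innerₗ P).compl₁₂ DV Qh.subtype
  let Φ : Vh × Qh →ₗ[ℝ] Module.Dual ℝ Vh × Module.Dual ℝ Qh :=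
    LinearMap.prod (A ∘ₗ LinearMap.fst ℝ Vh Qh - B ∘ₗ LinearMap.snd ℝ Vh Qh)
      (C ∘ₗ LinearMap.fst ℝ Vh Qh)
  have hΦ1 : ∀ (z : Vh × Qh) (v : Vh), (Φ z).1 v = ⟪G z.1, G v⟫ - ⟪D v, (z.2 : P)⟫ := fun z v => by
    rw [real_inner_comm (z.2 : P)]; rfl
  have hΦ2 : ∀ (z : Vh × Qh) (q : Qh), (Φ z).2 q = ⟪D z.1, (q : P)⟫ := fun z q => rfl
  -- The system is square, so uniqueness suffices. For zero data, testing with z itself gives G z =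
  -- 0, and inf-sup with L = 0 kills the pressure.
  have hinj : Function.Injective Φ := by
    rw [← LinearMap.ker_eq_bot, LinearMap.ker_eq_bot']
    intro z hz
    have h1 : ∀ v : Vh, ⟪G z.1, G v⟫ - ⟪D v, (z.2 : P)⟫ = 0 := fun v => by rw [← hΦ1, hz]; rfl
    have h2 : ⟪D z.1, (z.2 : P)⟫ = 0 := by rw [← hΦ2, hz]; rfl
    have h3 : G z.1 = 0 := by
      have := h1 z.1
      rwa [h2, sub_zero, inner_self_eq_zero] at this
    have h4 := hG0 _ z.1.2 h3
    have h5 := hIS z.2 z.2.2 0 le_rfl fun v hv => by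
      have := h1 ⟨v, hv⟩
      rw [h3, inner_zero_left, zero_sub] at this
      rw [this, zero_mul]
    have h6 : ‖(z.2 : P)‖ = 0 :=
      le_antisymm (nonpos_of_mul_nonpos_right h5 hβ) (norm_nonneg _)
    exact Prod.ext (Subtype.ext h4) (Subtype.ext (norm_eq_zero.1 h6))
  have hsurj : Function.Surjective Φ := by
    refine (LinearMap.injective_iff_surjective_of_finrank_eq_finrank ?_).1 hinj
    rw [Module.finrank_prod, Module.finrank_prod, Subspace.dual_finrank_eq,
      Subspace.dual_finrank_eq]
  let ℓ : Module.Dual ℝ Vh := (innerₗ K (G u)) ∘ₗ GV - (innerₗ P p) ∘ₗ DV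
  obtain ⟨z, hz⟩ := hsurj (ℓ, 0)
  refine ⟨z.1, z.1.2, z.2, z.2.2, fun v hv => ?_, fun q hq => ?_⟩
  · rw [← hΦ1 z ⟨v, hv⟩, hz, real_inner_comm p]; rfl
  · rw [← hΦ2 z ⟨q, hq⟩, hz]; rfl

end AbstractProjection

variable {d : ℕ} {Ω : Set (E d)}

/-! ### Existence, error and linearity of the Stokes projection. -/

section StokesProjection

variable {r : ℕ} {β c h : ℝ} {Vh : Submodule ℝ (H1 Ω)} {Qh : Submodule ℝ (L2 Ω ℝ)}

lemma IsStablePair.infSup (hS : IsStablePair r β c h Vh Qh) :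
    InfSup (divL Ω).toLinearMap Vh Qh β := by
  intro q hq L hL hb
  rcases eq_or_ne q 0 with rfl | hq0
  · simpa using hL
  have hqn : 0 < ‖q‖ := norm_pos_iff.2 hq0
  rw [← le_div_iff₀ hqn]
  -- `Real.iSup_le` asks for a nonnegative bound, since an empty real supremum is 0; this is where 0
  -- ≤ L in `InfSup` is used.
  refine (hS.inf_sup q hq hq0).trans (Real.iSup_le (fun v => ?_) (by positivity))
  have hvn : 0 < ‖v.1‖ := norm_pos_iff.2 v.2.2
  rw [div_le_div_iff₀ (by positivity) hqn, b_eq_inner, ← mul_assoc]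
  exact mul_le_mul_of_nonneg_right (hb v.1 v.2.1) hqn.le

lemma exists_poincare (hd : 0 < d) (hΩ : IsOpen Ω) (hΩb : Bornology.IsBounded Ω) :
    ∃ κ, 0 ≤ κ ∧ ∀ v ∈ V Ω, ‖toL2 v‖ ≤ κ * ‖gradL Ω v‖ := by
  obtain ⟨R, hR0, hR⟩ := hΩb.exists_pos_norm_le
  exact ⟨2 * R, by positivity, fun v hv =>
    (norm_toL2_le_of_mem_V hΩ hΩb hR0.le hR ⟨0, hd⟩ hv).trans
      (mul_le_mul_of_nonneg_left (norm_pd_le v _) (by positivity))⟩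

/-- Makes the `Classical.epsilon` choice meaningful. Existence is enough: the error bounds hold for
any pair satisfying the projection equations. -/
lemma IsStablePair.isStokesProjection (hd : 0 < d) (hΩ : IsOpen Ω) (hΩb : Bornology.IsBounded Ω)
    (hβ : 0 < β) (hS : IsStablePair r β c h Vh Qh) (u : H1 Ω) (p : L2 Ω ℝ) :
    IsStokesProjection Vh Qh u p (stokesProjection Vh Qh u p) := by
  refine Classical.epsilon_spec_aux ⟨(0, 0)⟩ _ ?_
  have := hS.finiteDimensional_velocity
  have := hS.finiteDimensional_pressure
  obtain ⟨κ, -, hκ⟩ := exists_poincare hd hΩ hΩb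
  obtain ⟨z, hz, s, hs, h1, h2⟩ := exists_saddlePoint (G := (gradL Ω).toLinearMap) hβ
    (fun v hv h0 => by
      have h0 : gradL Ω v = 0 := h0
      have h1 := hκ v (hS.velocity_le hv)
      rw [h0, norm_zero, mul_zero] at h1
      have h2 := norm_sq_eq v
      rw [h0, le_antisymm h1 (norm_nonneg _)] at h2
      simpa using h2) hS.infSup u p
  refine ⟨(z, s), hz, hs, fun v hv => ?_, fun q hq => ?_⟩
  · have := h1 v hv
    rw [a_eq_inner, a_eq_inner, b_eq_inner, b_eq_inner]
    exact this
  · rw [b_eq_inner, neg_eq_zero]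
    exact h2 q hq

/-- The error of the Stokes projection. -/
lemma exists_stokesProjection_error_le (Ω : Set (E d)) (r : ℕ) {β : ℝ} (hβ : 0 < β) (c : ℝ) :
    ∃ K, 0 ≤ K ∧ ∀ h : ℝ, 0 < h → ∀ (Vh : Submodule ℝ (H1 Ω)) (Qh : Submodule ℝ (L2 Ω ℝ)),
      IsStablePair r β c h Vh Qh → ∀ (v : Sobolev Ω (E d) (r + 1)) (q : Sobolev Ω ℝ r),
      toH1 (Nat.le_add_left 1 r) v ∈ V Ω → divergence (toH1 (Nat.le_add_left 1 r) v) = 0 →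
      toL2 q ∈ Q Ω → ∀ z, IsStokesProjection Vh Qh (toH1 (Nat.le_add_left 1 r) v) (toL2 q) z →
      ‖gradL Ω (toH1 (Nat.le_add_left 1 r) v - z.1)‖ ≤ K * h ^ r * (‖v‖ + ‖q‖) ∧
      ‖toL2 q - z.2‖ ≤ K * h ^ r * (‖v‖ + ‖q‖) := by
  set K₁ : ℝ := 1 + (1 + 2 * β⁻¹) * (1 + d)
  set K₂ : ℝ := 1 + β⁻¹ * (2 + 2 * β⁻¹) * (1 + d)
  have hK₁ : 0 ≤ K₁ := by positivity
  have hK₂ : 0 ≤ K₂ := by positivity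
  -- K₁ and K₂ are the quasi-optimality constants with cD = d. The sign of c is not assumed, hence
  -- |c|.
  refine ⟨(K₁ + K₂) * |c|, by positivity, fun h hh Vh Qh hS v q hv hdiv hq z hz => ?_⟩
  obtain ⟨w, hw, hvw⟩ := hS.approx_velocity v hv
  obtain ⟨s, hs, hqs⟩ := hS.approx_pressure q hq
  set ε := |c| * h ^ r * (‖v‖ + ‖q‖) with hε
  have hh' : 0 ≤ h ^ r := by positivity
  have h1 : ‖gradL Ω (toH1 (Nat.le_add_left 1 r) v - w)‖ ≤ ε := by
    rw [gradNorm_eq] at hvw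
    have e1 : h * ‖gradL Ω (toH1 (Nat.le_add_left 1 r) v - w)‖ ≤ h * (|c| * h ^ r * ‖v‖) := by
      have e2 : c * h ^ (r + 1) * ‖v‖ ≤ |c| * h ^ (r + 1) * ‖v‖ := by
        gcongr; exact le_abs_self c
      have e3 := norm_nonneg (toL2 v - toL2 w)
      rw [pow_succ] at hvw e2
      linarith
    refine (le_of_mul_le_mul_left e1 hh).trans ?_
    exact mul_le_mul_of_nonneg_left (by linarith [norm_nonneg q]) (by positivity)
  have h2 : ‖toL2 q - s‖ ≤ ε := by
    refine hqs.trans ?_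
    have e2 : c * h ^ r * ‖q‖ ≤ |c| * h ^ r * ‖q‖ := by
      gcongr; exact le_abs_self c
    refine e2.trans ?_
    exact mul_le_mul_of_nonneg_left (by linarith [norm_nonneg v]) (by positivity)
  obtain ⟨j1, j2⟩ := norm_projection_error_le (G := (gradL Ω).toLinearMap)
    (D := (divL Ω).toLinearMap) hβ (Nat.cast_nonneg d) norm_gradL_le norm_divL_le
    hS.infSup hz.velocity_mem hz.pressure_mem hw hs
    (fun v' hv' => by
      have := hz.momentum v' hv'
      rw [a_eq_inner, a_eq_inner, b_eq_inner, b_eq_inner] at this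
      exact this)
    (fun q' hq' => by
      have := hz.continuity q' hq'
      rw [b_eq_inner, neg_eq_zero] at this
      exact this)
    ((divL_apply _).trans hdiv) h1 h2
  have hε0 : 0 ≤ ε := by positivity
  have e : (K₁ + K₂) * |c| * h ^ r * (‖v‖ + ‖q‖) = K₁ * ε + K₂ * ε := by rw [hε]; ring
  rw [e]
  exact ⟨j1.trans (by linarith [mul_nonneg hK₂ hε0]), j2.trans (by linarith [mul_nonneg hK₁ hε0])⟩

/-- Linearity allows the error bound to be applied to increments in time, which gains the factor |y
- x| needed for consistency. -/
lemma IsStokesProjection.sub {u u' : H1 Ω} {p p' : L2 Ω ℝ} {z z' : H1 Ω × L2 Ω ℝ}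
    (hz : IsStokesProjection Vh Qh u p z) (hz' : IsStokesProjection Vh Qh u' p' z') :
    IsStokesProjection Vh Qh (u - u') (p - p') (z - z') := by
  refine ⟨Vh.sub_mem hz.velocity_mem hz'.velocity_mem, Qh.sub_mem hz.pressure_mem hz'.pressure_mem,
    fun v hv => ?_, fun q hq => ?_⟩
  · have h1 := hz.momentum v hv
    have h2 := hz'.momentum v hv
    simp only [a_eq_inner, b_eq_inner, Prod.fst_sub, Prod.snd_sub, map_sub, inner_sub_left,
      inner_sub_right] at h1 h2 ⊢
    linarith
  · have h1 := hz.continuity q hq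
    have h2 := hz'.continuity q hq
    simp only [b_eq_inner, Prod.fst_sub, map_sub, inner_sub_left] at h1 h2 ⊢
    linarith

lemma sub_mem_Q (hΩb : Bornology.IsBounded Ω) {p q : L2 Ω ℝ} (hp : p ∈ Q Ω) (hq : q ∈ Q Ω) :
    p - q ∈ Q Ω := by
  have hfin : IsFiniteMeasure (volume.restrict Ω) := ⟨by
    rw [Measure.restrict_apply_univ]; exact hΩb.measure_lt_top⟩
  have hi : ∀ g : L2 Ω ℝ, Integrable (g : E d → ℝ) (volume.restrict Ω) := fun g =>
    (Lp.memLp g).integrable (by norm_num)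
  have hp' : ∫ x in Ω, (p x : ℝ) = 0 := hp
  have hq' : ∫ x in Ω, (q x : ℝ) = 0 := hq
  change ∫ x in Ω, ((p - q : L2 Ω ℝ) x : ℝ) = 0
  rw [integral_congr_ae (Lp.coeFn_sub p q)]
  simp only [Pi.sub_apply]
  rw [integral_sub (hi p) (hi q), hp', hq', sub_zero]

end StokesProjection

/-! ### Time mesh and exact integration of affine functions. -/

section Mesh

variable {T : ℝ} (M : TimeMesh T)

lemma TimeMesh.step_pos {n : ℕ} (hn : n < M.N) : 0 < M.step n := sub_pos.2 (M.t_lt n hn)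

lemma TimeMesh.t_le_t {m n : ℕ} (hmn : m ≤ n) (hn : n ≤ M.N) : M.t m ≤ M.t n := by
  induction n, hmn using Nat.le_induction with
  | base => exact le_rfl
  | succ n _ ih => exact (ih (Nat.le_of_succ_le hn)).trans (M.t_lt n hn).le

lemma TimeMesh.t_mem {n : ℕ} (hn : n ≤ M.N) : M.t n ∈ Icc 0 T :=
  ⟨M.t_zero.symm.trans_le (M.t_le_t (Nat.zero_le n) hn), (M.t_le_t hn le_rfl).trans_eq M.t_last⟩

lemma TimeMesh.step_le_size {n : ℕ} (hn : n < M.N) : M.step n ≤ M.size :=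
  le_ciSup (f := fun n : Fin M.N => M.step n) (Set.finite_range _).bddAbove ⟨n, hn⟩

/-- The midpoint rule is exact for affine functions. Only the open interval matters, so kinks of the
velocity and jumps of the pressure at the nodes are harmless. -/
lemma integral_eq_of_affine {F : ℝ → ℝ} {x y α δ : ℝ} (hxy : x ≤ y)
    (hF : ∀ s ∈ Ioo x y, F s = α + s * δ) :
    ∫ s in x..y, F s = (y - x) * (α + (x + y) / 2 * δ) := by
  have e : ∫ s in x..y, F s = ∫ s in x..y, (α + s * δ) := by
    rw [intervalIntegral.integral_of_le hxy, intervalIntegral.integral_of_le hxy,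
      integral_Ioc_eq_integral_Ioo, integral_Ioc_eq_integral_Ioo]
    exact setIntegral_congr_fun measurableSet_Ioo hF
  rw [e, intervalIntegral.integral_add (by simp) (Continuous.intervalIntegrable (by fun_prop) _ _),
    intervalIntegral.integral_mul_const, integral_id]
  simp
  ring

end Mesh

/-! ### From the space-time scheme to nodal equations. -/

section Scheme

variable {T : ℝ} {M : TimeMesh T} {Vh : Submodule ℝ (H1 Ω)} {Qh : Submodule ℝ (L2 Ω ℝ)}
  {f : ℝ → L2 Ω (E d)} {u₀h : H1 Ω} {uh : ℝ → H1 Ω} {ph : ℝ → L2 Ω ℝ}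

/-- Continuity extends the affine formula from the half-open to the closed subinterval, so that it
also covers the left node. -/
lemma exists_affine_of_mem_Xspace {w : ℝ → H1 Ω} (hw : w ∈ Xspace M 1 Vh) {n : ℕ} (hn : n < M.N) :
    ∃ c₀ ∈ Vh, ∃ c₁ ∈ Vh, ∀ s ∈ Icc (M.t n) (M.t (n + 1)), w s = c₀ + s • c₁ := by
  obtain ⟨c, hc, h⟩ := hw.2 n hn
  refine ⟨c 0, hc 0, c 1, hc 1, ?_⟩
  have hlt := M.t_lt n hn
  refine Set.EqOn.of_subset_closure (s := Ioc (M.t n) (M.t (n + 1))) (fun s hs => ?_)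
    (hw.1.mono (Icc_subset_Icc (M.t_mem hn.le).1 (M.t_mem hn).2))
    (by fun_prop) Ioc_subset_Icc_self (by rw [closure_Ioc hlt.ne])
  rw [h s hs]
  simp [Finset.sum_range_succ]

lemma exists_affine_of_mem_Yspace {w : ℝ → L2 Ω ℝ} (hw : w ∈ Yspace M 1 Qh) {n : ℕ}
    (hn : n < M.N) :
    ∃ c₀ ∈ Qh, ∃ c₁ ∈ Qh, ∀ s ∈ Ioc (M.t n) (M.t (n + 1)), w s = c₀ + s • c₁ := by
  obtain ⟨c, hc, h⟩ := hw n hn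
  refine ⟨c 0, hc 0, c 1, hc 1, fun s hs => ?_⟩
  rw [h s hs]
  simp [Finset.sum_range_succ]

lemma TimeMesh.mid_mem {n : ℕ} (hn : n < M.N) : M.mid n ∈ Ioc (M.t n) (M.t (n + 1)) := by
  have := M.t_lt n hn
  exact ⟨by rw [TimeMesh.mid]; linarith, by rw [TimeMesh.mid]; linarith⟩

lemma IsDiscreteSolution.pressure_mid_mem (hs : IsDiscreteSolution M Vh Qh f u₀h uh ph) {n : ℕ}
    (hn : n < M.N) : ph (M.mid n) ∈ Qh := by
  obtain ⟨c₀, h₀, c₁, h₁, h⟩ := exists_affine_of_mem_Yspace hs.pressure_mem hn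
  rw [h _ (TimeMesh.mid_mem hn)]
  exact Qh.add_mem h₀ (Qh.smul_mem _ h₁)

/-- The values of a discrete solution at the nodes satisfy the Crank–Nicolson scheme. -/
lemma IsDiscreteSolution.crankNicolson (hs : IsDiscreteSolution M Vh Qh f u₀h uh ph) {n : ℕ}
    (hn : n < M.N) {v : H1 Ω} (hv : v ∈ Vh) :
    ⟪toL2 (uh (M.t (n + 1)) - uh (M.t n)), toL2 v⟫
      + M.step n / 2 * a (uh (M.t n) + uh (M.t (n + 1))) v + M.step n * b v (ph (M.mid n))
      = M.step n / 2 * (⟪f (M.t n), toL2 v⟫ + ⟪f (M.t (n + 1)), toL2 v⟫) := by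
  obtain ⟨c₀, -, c₁, -, hu⟩ := exists_affine_of_mem_Xspace hs.velocity_mem hn
  obtain ⟨d₀, -, d₁, -, hp⟩ := exists_affine_of_mem_Yspace hs.pressure_mem hn
  have hlt := M.t_lt n hn
  have key := hs.momentum n hn v hv
  have hder : ∀ s ∈ Ioo (M.t n) (M.t (n + 1)), deriv (fun σ => toL2 (uh σ)) s = toL2 c₁ := by
    intro s hs
    have h1 : HasDerivAt (fun σ : ℝ => c₀ + σ • c₁) ((1 : ℝ) • c₁) s :=
      ((hasDerivAt_id s).smul_const c₁).const_add c₀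
    have h2 := (toL2L Ω (E d) 1).hasFDerivAt.comp_hasDerivAt s h1
    rw [one_smul] at h2
    refine (h2.congr_of_eventuallyEq ?_).deriv
    filter_upwards [Icc_mem_nhds hs.1 hs.2] with σ hσ
    rw [hu σ hσ]
    rfl
  -- The whole integrand is affine in time, so its integral is the step length times its midpoint
  -- value; the pressure survives only there.
  rw [integral_eq_of_affine (α := ⟪toL2 c₁, toL2 v⟫ + ⟪gradL Ω c₀, gradL Ω v⟫ - ⟪divL Ω v, d₀⟫)
    (δ := ⟪gradL Ω c₁, gradL Ω v⟫ - ⟪divL Ω v, d₁⟫) hlt.le (fun s hs => by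
      rw [hder s hs, hu s (Ioo_subset_Icc_self hs), hp s (Ioo_subset_Ioc_self hs), a_eq_inner,
        b_eq_inner, map_add, map_smul, inner_add_left, inner_add_right, real_inner_smul_left,
        real_inner_smul_right]
      ring)] at key
  rw [TimeMesh.trapezoidal] at key
  rw [← key, hu _ (left_mem_Icc.2 hlt.le), hu _ (right_mem_Icc.2 hlt.le),
    hp _ (TimeMesh.mid_mem hn), ← toL2L_apply, ← toL2L_apply, ← toL2L_apply, a_eq_inner, b_eq_inner]
  simp only [map_add, map_sub, map_smul, inner_add_left, inner_sub_left, inner_add_right,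
    real_inner_smul_left, real_inner_smul_right, TimeMesh.step, TimeMesh.mid]
  ring

/-- The integrated constraint says that the two nodal discrete divergences on a subinterval add up
to zero, so a divergence-free initial value propagates from node to node. -/
lemma IsDiscreteSolution.velocity_mem_Vdiv (hs : IsDiscreteSolution M Vh Qh f u₀h uh ph)
    (hu₀ : u₀h ∈ Vdiv Vh Qh) {n : ℕ} (hn : n ≤ M.N) : uh (M.t n) ∈ Vdiv Vh Qh := by
  induction n with
  | zero => rwa [M.t_zero, hs.initial]
  | succ n ih =>
    have hn' : n < M.N := hn
    obtain ⟨c₀, h₀, c₁, h₁, hu⟩ := exists_affine_of_mem_Xspace hs.velocity_mem hn'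
    have hlt := M.t_lt n hn'
    refine ⟨?_, fun q hq => ?_⟩
    · rw [hu _ (right_mem_Icc.2 hlt.le)]
      exact Vh.add_mem h₀ (Vh.smul_mem _ h₁)
    · have key := hs.continuity n hn' q hq
      rw [integral_eq_of_affine (α := -⟪divL Ω c₀, q⟫) (δ := -⟪divL Ω c₁, q⟫) hlt.le (fun s hs => by
        rw [hu s (Ioo_subset_Icc_self hs), b_eq_inner, map_add, map_smul, inner_add_left,
          real_inner_smul_left]
        ring)] at key
      have key := (mul_eq_zero.1 key).resolve_left (sub_pos.2 hlt).ne'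
      have h0 := (ih hn'.le).2 q hq
      rw [b_eq_inner, hu _ (left_mem_Icc.2 hlt.le), map_add, map_smul, inner_add_left,
        real_inner_smul_left] at h0
      rw [b_eq_inner, hu _ (right_mem_Icc.2 hlt.le), map_add, map_smul, inner_add_left,
        real_inner_smul_left]
      linarith

end Scheme

end StokesFEM
end

noncomputable section
namespace StokesFEM

variable {d : ℕ} {Ω : Set (E d)}

/-! ### Error equation and consistency error. -/

section ErrorAnalysis

/-- The error equation: the difference between the Stokes projection and the discrete solution
satisfies a Crank–Nicolson scheme with the consistency error as right-hand side. -/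
lemma IsDiscreteSolution.error_equation (hΩ : IsOpen Ω) (hΩb : Bornology.IsBounded Ω) {T : ℝ}
    {f : ℝ → L2 Ω (E d)} {u₀ : L2 Ω (E d)} {r : ℕ} {hr : 1 ≤ r}
    {u : ℝ → Sobolev Ω (E d) (r + 1)} {p : ℝ → Sobolev Ω ℝ r}
    (hsol : IsStokesSolution T f u₀ hr u p) {M : TimeMesh T} {Vh : Submodule ℝ (H1 Ω)}
    {Qh : Submodule ℝ (L2 Ω ℝ)} (hV : Vh ≤ V Ω) {u₀h : H1 Ω} {uh : ℝ → H1 Ω} {ph : ℝ → L2 Ω ℝ}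
    (hs : IsDiscreteSolution M Vh Qh f u₀h uh ph) {z : ℕ → H1 Ω × L2 Ω ℝ}
    (hz : ∀ m ≤ M.N, IsStokesProjection Vh Qh (toH1 (Nat.le_add_left 1 r) (u (M.t m)))
      (toL2 (p (M.t m))) (z m)) {n : ℕ} (hn : n < M.N) {v : H1 Ω} (hv : v ∈ Vh) :
    ⟪toL2 (((z (n + 1)).1 - uh (M.t (n + 1))) - ((z n).1 - uh (M.t n))), toL2 v⟫
      + M.step n / 2 * ⟪gradL Ω (((z n).1 - uh (M.t n))
          + ((z (n + 1)).1 - uh (M.t (n + 1)))), gradL Ω v⟫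
      - M.step n * ⟪divL Ω v, (1 / 2 : ℝ) • ((z n).2 + (z (n + 1)).2) - ph (M.mid n)⟫
      = ⟪toL2 ((z (n + 1)).1 - (z n).1)
        - (M.step n / 2) • (derivWithin (fun s => toL2 (u s)) (Icc 0 T) (M.t n)
          + derivWithin (fun s => toL2 (u s)) (Icc 0 T) (M.t (n + 1))), toL2 v⟫ := by
  have h1 := hs.crankNicolson hn hv
  have h2 := (hz n hn.le).momentum v hv
  have h3 := (hz (n + 1) hn).momentum v hv
  have h4 := hsol.weak_momentum hΩ hΩb (M.t_mem hn.le) (hV hv)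
  have h5 := hsol.weak_momentum hΩ hΩb (M.t_mem (n := n + 1) hn) (hV hv)
  simp only [a_eq_inner, b_eq_inner, ← toL2L_apply, map_add, map_sub, inner_add_left,
    inner_sub_left, inner_add_right, inner_sub_right, real_inner_smul_left,
    real_inner_smul_right] at h1 h2 h3 h4 h5 ⊢
  -- Minus the scheme, plus half a step times the projection and weak momentum equations at both
  -- nodes. The source terms cancel because the quadrature uses the same nodal values of f.
  linear_combination (-1 : ℝ) * h1 + M.step n / 2 * (h2 + h3 + h4 + h5)

/-- The consistency error. -/
lemma norm_consistency_error_le (hΩb : Bornology.IsBounded Ω) {T : ℝ} {f : ℝ → L2 Ω (E d)}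
    {u₀ : L2 Ω (E d)} {r : ℕ} {hr : 1 ≤ r}
    {u : ℝ → Sobolev Ω (E d) (r + 1)} {p : ℝ → Sobolev Ω ℝ r}
    (hsol : IsStokesSolution T f u₀ hr u p) {κ K Lu Lp Kt h : ℝ}
    {Vh : Submodule ℝ (H1 Ω)} {Qh : Submodule ℝ (L2 Ω ℝ)} (hV : Vh ≤ V Ω) (hκ0 : 0 ≤ κ)
    (hκ : ∀ v ∈ V Ω, ‖toL2 v‖ ≤ κ * ‖gradL Ω v‖) (hKh : 0 ≤ K * h ^ r)
    (hK : ∀ (v : Sobolev Ω (E d) (r + 1)) (q : Sobolev Ω ℝ r),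
      toH1 (Nat.le_add_left 1 r) v ∈ V Ω → divergence (toH1 (Nat.le_add_left 1 r) v) = 0 →
      toL2 q ∈ Q Ω → ∀ z, IsStokesProjection Vh Qh (toH1 (Nat.le_add_left 1 r) v) (toL2 q) z →
      ‖gradL Ω (toH1 (Nat.le_add_left 1 r) v - z.1)‖ ≤ K * h ^ r * (‖v‖ + ‖q‖))
    {x y : ℝ} (hx : x ∈ Icc 0 T) (hy : y ∈ Icc 0 T) (hLu : ‖u y - u x‖ ≤ Lu * |y - x|)
    (hLp : ‖p y - p x‖ ≤ Lp * |y - x|)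
    (hKt : ‖toL2 (u y) - toL2 (u x) - ((y - x) / 2) • (derivWithin (fun s => toL2 (u s)) (Icc 0 T) x
      + derivWithin (fun s => toL2 (u s)) (Icc 0 T) y)‖ ≤ Kt * |y - x| ^ 3)
    {z z' : H1 Ω × L2 Ω ℝ}
    (hz : IsStokesProjection Vh Qh (toH1 (Nat.le_add_left 1 r) (u x)) (toL2 (p x)) z)
    (hz' : IsStokesProjection Vh Qh (toH1 (Nat.le_add_left 1 r) (u y)) (toL2 (p y)) z') :
    ‖toL2 (z'.1 - z.1) - ((y - x) / 2) • (derivWithin (fun s => toL2 (u s)) (Icc 0 T) x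
      + derivWithin (fun s => toL2 (u s)) (Icc 0 T) y)‖
      ≤ κ * K * (Lu + Lp) * h ^ r * |y - x| + Kt * |y - x| ^ 3 := by
  have hmem : toH1 (Nat.le_add_left 1 r) (u y - u x) ∈ V Ω :=
    (V Ω).sub_mem (hsol.boundary y hy) (hsol.boundary x hx)
  have hdiv : divergence (toH1 (Nat.le_add_left 1 r) (u y - u x)) = 0 := by
    have e : toH1 (Nat.le_add_left 1 r) (u y - u x)
      = toH1 (Nat.le_add_left 1 r) (u y) - toH1 (Nat.le_add_left 1 r) (u x) := rfl
    rw [e, ← divL_apply, map_sub, divL_apply, divL_apply, hsol.divergence_free y hy,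
      hsol.divergence_free x hx, sub_zero]
  have hQ : toL2 (p y - p x) ∈ Q Ω := sub_mem_Q hΩb (hsol.mean_zero y hy) (hsol.mean_zero x hx)
  have h1 := hK _ _ hmem hdiv hQ (z' - z) (hz'.sub hz)
  -- The L² projection error comes from the gradient error by Poincaré rather than by duality: only
  -- order h^r, but no elliptic regularity of Ω is needed.
  have h2 := hκ _ ((V Ω).sub_mem hmem (hV (hz'.sub hz).velocity_mem))
  have h3 : ‖toL2 (toH1 (Nat.le_add_left 1 r) (u y - u x) - (z' - z).1)‖
      ≤ κ * K * (Lu + Lp) * h ^ r * |y - x| := by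
    refine (h2.trans (mul_le_mul_of_nonneg_left (h1.trans
      (mul_le_mul_of_nonneg_left (add_le_add hLu hLp) hKh)) hκ0)).trans (le_of_eq (by ring))
  have e : toL2 (z'.1 - z.1) - ((y - x) / 2) • (derivWithin (fun s => toL2 (u s)) (Icc 0 T) x
      + derivWithin (fun s => toL2 (u s)) (Icc 0 T) y)
      = (toL2 (u y) - toL2 (u x) - ((y - x) / 2) • (derivWithin (fun s => toL2 (u s)) (Icc 0 T) x
      + derivWithin (fun s => toL2 (u s)) (Icc 0 T) y))
      - toL2 (toH1 (Nat.le_add_left 1 r) (u y - u x) - (z' - z).1) := by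
    have e1 : toL2 (toH1 (Nat.le_add_left 1 r) (u y - u x) - (z' - z).1)
        = toL2 (u y) - toL2 (u x) - toL2 (z'.1 - z.1) := rfl
    rw [e1]
    abel
  rw [e]
  exact (norm_sub_le _ _).trans (by linarith)

lemma norm_add_add_sq_le {F : Type*} [SeminormedAddCommGroup F] (x y z : F) :
    ‖x + y + z‖ ^ 2 ≤ 3 * (‖x‖ ^ 2 + ‖y‖ ^ 2 + ‖z‖ ^ 2) := by
  refine (pow_le_pow_left₀ (norm_nonneg _) (norm_add₃_le (a := x) (b := y) (c := z)) 2).trans ?_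
  linarith [sq_nonneg (‖x‖ - ‖y‖), sq_nonneg (‖x‖ - ‖z‖), sq_nonneg (‖y‖ - ‖z‖)]

end ErrorAnalysis

end StokesFEM
end

/-! ### Assembly of the pressure estimate. -/

theorem mainTheorem1 {d : ℕ} (hd : d = 2 ∨ d = 3) (Ω : Set (StokesFEM.E d)) (hΩ : IsOpen Ω)
    (hΩb : Bornology.IsBounded Ω) (T : ℝ) (hT : 0 < T) (r : ℕ) (hr : 1 ≤ r)
    (f : ℝ → StokesFEM.L2 Ω (StokesFEM.E d)) (u₀ : StokesFEM.L2 Ω (StokesFEM.E d))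
    (u : ℝ → StokesFEM.Sobolev Ω (StokesFEM.E d) (r + 1)) (p : ℝ → StokesFEM.Sobolev Ω ℝ r)
    (hsol : StokesFEM.IsStokesSolution T f u₀ hr u p) (hreg : StokesFEM.IsRegular T u p)
    (β c : ℝ) (hβ : 0 < β) :
    ∃ C : ℝ, ∀ (h : ℝ), 0 < h →
      ∀ (Vh : Submodule ℝ (StokesFEM.H1 Ω)) (Qh : Submodule ℝ (StokesFEM.L2 Ω ℝ)),
        StokesFEM.IsStablePair r β c h Vh Qh →
      ∀ (M : StokesFEM.TimeMesh T) (u₀h : StokesFEM.H1 Ω), u₀h ∈ StokesFEM.Vdiv Vh Qh →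
      ∀ (uh : ℝ → StokesFEM.H1 Ω) (ph : ℝ → StokesFEM.L2 Ω ℝ),
        StokesFEM.IsDiscreteSolution M Vh Qh f u₀h uh ph →
      ∀ n : ℕ, 1 ≤ n → n ≤ M.N →
        ∑ m ∈ Finset.range n, M.step m * ‖StokesFEM.toL2 (p (M.mid m)) - ph (M.mid m)‖ ^ 2
          ≤ C * (StokesFEM.gradNorm
                (StokesFEM.initialError Vh Qh (StokesFEM.toH1 (Nat.le_add_left 1 r) (u 0))
                  (StokesFEM.toL2 (p 0)) u₀h) ^ 2
              + M.size ^ 4 + h ^ (2 * r)) := by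
  open StokesFEM in
  have hd0 : 0 < d := by omega
  obtain ⟨κ, hκ0, hκ⟩ := exists_poincare hd0 hΩ hΩb
  obtain ⟨K, hK0, hK⟩ := exists_stokesProjection_error_le Ω r hβ c
  obtain ⟨Kt, hKt0, hKt⟩ := exists_trapezoidal_error_le hT hreg.velocity_L2
  obtain ⟨Km, hKm0, hKm⟩ := exists_midpoint_error_le hT hreg.pressure_L2
  obtain ⟨Lu, hLu0, hLu⟩ := exists_lipschitz_of_contDiffOn hT hreg.velocity_Sobolev
  obtain ⟨Lp, hLp0, hLp⟩ := exists_lipschitz_of_contDiffOn hT hreg.pressure_Sobolev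
  obtain ⟨Bu, hBu0, hBu⟩ := exists_norm_le_of_continuousOn hreg.velocity_Sobolev.continuousOn
  obtain ⟨Bp, hBp0, hBp⟩ := exists_norm_le_of_continuousOn hreg.pressure_Sobolev.continuousOn
  set A := κ * K * (Lu + Lp) with hA
  set B := K * (Bu + Bp) with hB
  have hA0 : 0 ≤ A := by positivity
  have hB0 : 0 ≤ B := by positivity
  set C₀ := 3 * (β⁻¹) ^ 2 * (1 + T) with hC₀
  have hC₀0 : 0 ≤ C₀ := by positivity
  -- The first summand pays for time interpolation and projection of p, the second for η through the
  -- bound on γ². Each factor 3 comes from squaring a sum of three terms.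
  refine ⟨3 * T * (Km ^ 2 + B ^ 2) + 3 * C₀ * (1 + 4 * T * (A ^ 2 + Kt ^ 2)), ?_⟩
  intro h hh Vh Qh hS M u₀h hu₀h uh ph hs n _ hn
  set τ := M.size with hτ
  have hN : 0 < M.N := by omega
  have hτ0 : 0 ≤ τ := (M.step_pos hN).le.trans (M.step_le_size hN)
  have hh0 : 0 ≤ h ^ r := by positivity
  set z : ℕ → H1 Ω × L2 Ω ℝ := fun m => stokesProjection Vh Qh
    (toH1 (Nat.le_add_left 1 r) (u (M.t m))) (toL2 (p (M.t m))) with hzd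
  have hz : ∀ m, IsStokesProjection Vh Qh (toH1 (Nat.le_add_left 1 r) (u (M.t m)))
      (toL2 (p (M.t m))) (z m) := fun m => hS.isStokesProjection hd0 hΩ hΩb hβ _ _
  set θ : ℕ → H1 Ω := fun m => (z m).1 - uh (M.t m) with hθ
  -- Averaging the nodal projections, instead of projecting at the midpoint, leaves no pressure
  -- residual in the error equation.
  set η : ℕ → L2 Ω ℝ := fun m => (1 / 2 : ℝ) • ((z m).2 + (z (m + 1)).2) - ph (M.mid m) with hη
  set ρ : ℕ → L2 Ω (E d) := fun m => toL2 ((z (m + 1)).1 - (z m).1)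
        - (M.step m / 2) • (derivWithin (fun s => toL2 (u s)) (Icc 0 T) (M.t m)
          + derivWithin (fun s => toL2 (u s)) (Icc 0 T) (M.t (m + 1))) with hρ
  set γ := A * h ^ r + Kt * τ ^ 2 with hγ
  have hγ0 : 0 ≤ γ := by positivity
  have hρle : ∀ m < M.N, ‖ρ m‖ ≤ M.step m * γ := by
    intro m hm
    have hst := M.step_pos hm
    have habs : |M.t (m + 1) - M.t m| = M.step m := abs_of_pos hst
    have h1 := norm_consistency_error_le hΩb hsol hS.velocity_le hκ0 hκ (mul_nonneg hK0 hh0)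
      (fun v q hv hd hq z hz => (hK h hh Vh Qh hS v q hv hd hq z hz).1)
      (M.t_mem hm.le) (M.t_mem hm) (hLu _ (M.t_mem hm.le) _ (M.t_mem hm))
      (hLp _ (M.t_mem hm.le) _ (M.t_mem hm)) (hKt _ (M.t_mem hm.le) _ (M.t_mem hm))
      (hz m) (hz (m + 1))
    rw [habs] at h1
    refine h1.trans ?_
    -- One of the three powers of the local step is kept, since the error is divided by it in g
    -- below.
    have h2 : M.step m ^ 2 ≤ τ ^ 2 := pow_le_pow_left₀ hst.le (M.step_le_size hm) 2
    have h3 := mul_le_mul_of_nonneg_left h2 (mul_nonneg hst.le hKt0)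
    rw [hγ, hA]
    linarith
  have hpress := crankNicolson_pressure (J := (toL2L Ω (E d) 1).toLinearMap)
    (G := (gradL Ω).toLinearMap) (D := (divL Ω).toLinearMap) hβ norm_toL2_le norm_gradL_le
    hS.infSup M.t_lt M.t_zero (fun m hm => (M.t_mem hm).2) (θ := θ) (η := η)
    (g := fun m => (M.step m)⁻¹ • ρ m) (γ := γ)
    (fun m hm => Vh.sub_mem (hz m).velocity_mem (hs.velocity_mem_Vdiv hu₀h hm).1)
    (fun m hm => Qh.sub_mem (Qh.smul_mem _ (Qh.add_mem (hz m).pressure_mem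
      (hz (m + 1)).pressure_mem)) (hs.pressure_mid_mem hm))
    (fun m hm q hq => by
      have h1 := (hz m).continuity q hq
      have h2 := (hs.velocity_mem_Vdiv hu₀h hm).2 q hq
      rw [b_eq_inner, neg_eq_zero] at h1 h2
      change inner ℝ (divL Ω (θ m)) q = 0
      rw [hθ, map_sub, inner_sub_left, h1, h2, sub_zero])
    hγ0
    (fun m hm => by
      have hst := M.step_pos hm
      rw [norm_smul, norm_inv, Real.norm_of_nonneg hst.le, inv_mul_eq_div, div_le_iff₀ hst,
        mul_comm γ]
      exact hρle m hm)
    (fun m hm v hv => by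
      have h1 := hs.error_equation hΩ hΩb hsol hS.velocity_le (fun m _ => hz m) hm hv
      rw [real_inner_smul_left, ← mul_assoc]
      change _ = M.step m * (M.step m)⁻¹ * _
      rw [mul_inv_cancel₀ (M.step_pos hm).ne', one_mul]
      exact h1) n hn
  have hθ0 : θ 0 = initialError Vh Qh (toH1 (Nat.le_add_left 1 r) (u 0)) (toL2 (p 0)) u₀h := by
    simp only [hθ, hzd, initialError, M.t_zero, hs.initial]
  have hpress' : ∑ m ∈ Finset.range n, M.step m * ‖η m‖ ^ 2
      ≤ C₀ * (gradNorm (initialError Vh Qh (toH1 (Nat.le_add_left 1 r) (u 0))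
        (toL2 (p 0)) u₀h) ^ 2 + 2 * T * γ ^ 2) := by
    rw [gradNorm_eq, ← hθ0]
    exact hpress
  set e₀ := gradNorm (initialError Vh Qh (toH1 (Nat.le_add_left 1 r) (u 0)) (toL2 (p 0)) u₀h)
  have hterm : ∀ m ∈ Finset.range n, M.step m * ‖toL2 (p (M.mid m)) - ph (M.mid m)‖ ^ 2
      ≤ M.step m * (3 * (Km ^ 2 * τ ^ 4 + B ^ 2 * h ^ (2 * r)))
        + 3 * (M.step m * ‖η m‖ ^ 2) := by
    intro m hm
    have hm : m < M.N := (Finset.mem_range.1 hm).trans_le hn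
    have hst := M.step_pos hm
    have hz1 : ∀ k ≤ M.N, ‖toL2 (p (M.t k)) - (z k).2‖ ≤ B * h ^ r := fun k hk => by
      have ht := M.t_mem hk
      have h1 := (hK h hh Vh Qh hS _ _ (hsol.boundary _ ht) (hsol.divergence_free _ ht)
        (hsol.mean_zero _ ht) _ (hz k)).2
      refine h1.trans ((mul_le_mul_of_nonneg_left (add_le_add (hBu _ ht) (hBp _ ht))
        (mul_nonneg hK0 hh0)).trans (le_of_eq (by rw [hB]; ring)))
    have h1 : ‖toL2 (p (M.mid m)) - (1 / 2 : ℝ) • (toL2 (p (M.t m)) + toL2 (p (M.t (m + 1))))‖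
        ≤ Km * τ ^ 2 := by
      refine (hKm _ (M.t_mem hm.le) _ (M.t_mem hm)).trans (mul_le_mul_of_nonneg_left ?_ hKm0)
      refine pow_le_pow_left₀ (abs_nonneg _) ?_ 2
      exact (abs_of_pos hst).trans_le (M.step_le_size hm)
    have h2 : ‖(1 / 2 : ℝ) • ((toL2 (p (M.t m)) - (z m).2)
        + (toL2 (p (M.t (m + 1))) - (z (m + 1)).2))‖ ≤ B * h ^ r := by
      rw [norm_smul, Real.norm_of_nonneg (by norm_num)]
      have := (norm_add_le _ _).trans (add_le_add (hz1 m hm.le) (hz1 (m + 1) hm))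
      linarith
    -- Midpoint interpolation error, averaged projection error at the nodes, and discrete error.
    have e : toL2 (p (M.mid m)) - ph (M.mid m)
        = (toL2 (p (M.mid m)) - (1 / 2 : ℝ) • (toL2 (p (M.t m)) + toL2 (p (M.t (m + 1)))))
        + (1 / 2 : ℝ) • ((toL2 (p (M.t m)) - (z m).2)
          + (toL2 (p (M.t (m + 1))) - (z (m + 1)).2)) + η m := by
      rw [hη]; module
    have h3 := norm_add_add_sq_le
      (toL2 (p (M.mid m)) - (1 / 2 : ℝ) • (toL2 (p (M.t m)) + toL2 (p (M.t (m + 1)))))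
      ((1 / 2 : ℝ) • ((toL2 (p (M.t m)) - (z m).2) + (toL2 (p (M.t (m + 1))) - (z (m + 1)).2)))
      (η m)
    rw [← e] at h3
    have h4 := pow_le_pow_left₀ (norm_nonneg _) h1 2
    have h5 := pow_le_pow_left₀ (norm_nonneg _) h2 2
    have e4 : (Km * τ ^ 2) ^ 2 = Km ^ 2 * τ ^ 4 := by ring
    have e5 : (B * h ^ r) ^ 2 = B ^ 2 * h ^ (2 * r) := by rw [mul_comm 2 r, pow_mul]; ring
    rw [e4] at h4
    rw [e5] at h5
    have h6 : ‖toL2 (p (M.mid m)) - ph (M.mid m)‖ ^ 2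
        ≤ 3 * (Km ^ 2 * τ ^ 4 + B ^ 2 * h ^ (2 * r)) + 3 * ‖η m‖ ^ 2 := by linarith
    have h7 := mul_le_mul_of_nonneg_left h6 hst.le
    linarith
  refine (Finset.sum_le_sum hterm).trans ?_
  rw [Finset.sum_add_distrib, ← Finset.sum_mul, ← Finset.mul_sum]
  have hsum : ∑ m ∈ Finset.range n, M.step m ≤ T := by
    have : ∑ m ∈ Finset.range n, M.step m = M.t n - M.t 0 := Finset.sum_range_sub _ _
    rw [this, M.t_zero, sub_zero]
    exact (M.t_mem hn).2
  set H := h ^ (2 * r) with hH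
  have hH0 : 0 ≤ H := by positivity
  have hγ2 : γ ^ 2 ≤ 2 * (A ^ 2 + Kt ^ 2) * (τ ^ 4 + H) := by
    have e1 : (A * h ^ r) ^ 2 = A ^ 2 * H := by rw [hH, mul_comm 2 r, pow_mul]; ring
    have e2 : (Kt * τ ^ 2) ^ 2 = Kt ^ 2 * τ ^ 4 := by ring
    have e3 : γ ^ 2 ≤ 2 * ((A * h ^ r) ^ 2 + (Kt * τ ^ 2) ^ 2) := by
      rw [hγ]; linarith [sq_nonneg (A * h ^ r - Kt * τ ^ 2)]
    rw [e1, e2] at e3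
    have e4 : 0 ≤ A ^ 2 * τ ^ 4 := by positivity
    have e5 : 0 ≤ Kt ^ 2 * H := by positivity
    linarith
  have hτ4 : 0 ≤ τ ^ 4 := by positivity
  set S := e₀ ^ 2 + τ ^ 4 + H with hSd
  have he₀ : 0 ≤ e₀ ^ 2 := sq_nonneg _
  have i1 : (∑ m ∈ Finset.range n, M.step m) * (3 * (Km ^ 2 * τ ^ 4 + B ^ 2 * H))
      ≤ 3 * T * (Km ^ 2 + B ^ 2) * S := by
    have j1 : Km ^ 2 * τ ^ 4 ≤ Km ^ 2 * S :=
      mul_le_mul_of_nonneg_left (by linarith) (sq_nonneg _)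
    have j2 : B ^ 2 * H ≤ B ^ 2 * S := mul_le_mul_of_nonneg_left (by linarith) (sq_nonneg _)
    calc _ ≤ T * (3 * (Km ^ 2 * S + B ^ 2 * S)) :=
          mul_le_mul hsum (by linarith) (by positivity) hT.le
      _ = _ := by ring
  have i2 : e₀ ^ 2 + 2 * T * γ ^ 2 ≤ (1 + 4 * T * (A ^ 2 + Kt ^ 2)) * S := by
    have j1 : 2 * T * γ ^ 2 ≤ 2 * T * (2 * (A ^ 2 + Kt ^ 2) * S) :=
      mul_le_mul_of_nonneg_left (hγ2.trans
        (mul_le_mul_of_nonneg_left (by linarith) (by positivity))) (by positivity)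
    linarith
  have i3 := mul_le_mul_of_nonneg_left i2 hC₀0
  linarith
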